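/- Let $T,\alpha,\beta>0$. For $u\in L^1(0,T)$ let $Du$ be its distributional derivative on $(0,T)$, let $\|\cdot\|_M$ be the norm of $M(0,T)=C_0(0,T)^*$, let $\mathrm{BV}(0,T)=\{u\in L^1(0,T): Du\in M(0,T)\}\subset L^2(0,T)$ with $\|u\|_{\mathrm{BV}}=\|u\|_{L^1}+\|Du\|_M$, and put $$\operatorname{TGV}(u)=\inf_{w\in \mathrm{BV}(0,T)}\alpha\|Du-w\|_M+\beta\|Dw\|_M,\qquad J(u)=f(u)+\operatorname{TGV}(u)\quad (u\in \mathrm{BV}(0,T)).$$ Assume that $f:L^2(0,T)\to\mathbb R$ is continuously Fréchet differentiable, that its $L^2$-gradient $\nabla f$ is Lipschitz with constant $L_f>0$, that $f\ge -C_f$ for some $C_f>0$, that the sublevel sets of $J$ are bounded in $\mathrm{BV}(0,T)$, and that $f$ is convex. Put $M_0=f(0)+C_f$. Let $\mathcal L$ be the space of affine functions on $(0,T)$, let $S_x=1_{(x,T)}$, and let $K_x(t)=1_{(0,x)}(t)(x-t)$ if $x<T/2$ and $K_x(t)=1_{(x,T)}(t)(t-x)$ if $x\ge T/2$. Let $\operatorname{Ext}B=\{\pm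 S_x/\alpha: x\in(0,T)\}\cup\{\pm K_x/\beta: x\in(\beta/\alpha,T-\beta/\alpha)\}$. For a finite set $\mathcal A\subset\operatorname{Ext}B$ let $(\mathcal P(\mathcal A))$ be the problem of minimizing $f(\sum_{v\in\mathcal A}\lambda_v v+\ell)+\sum_{v\in\mathcal A}\lambda_v$ over $\lambda\ge0$ and $\ell\in\mathcal L$. Consider the following algorithm. Given a finite set $\mathcal A_0\subset\operatorname{Ext}B$, take a minimizer $(\lambda^1,\ell^1)$ of $(\mathcal P(\mathcal A_0))$, put $u_1=\sum_{v\in\mathcal A_0}\lambda^1_v v+\ell^1$ and let $\mathcal A_1$ be the set of $v\in\mathcal A_0$ with $\lambda^1_v\ne0$. For $k=1,2,\dots$ let $p_k(x)=\int_0^x\nabla f(u_k)(s)\,ds$ and $P_k(x)=-\int_0^x p_k(s)\,ds$, and choose $\hat x^S_k,\hat x^K_k\in(0,T)$ with $|p_k(\hat x_k^S)|=\|p_k\|_C$ and $|P_k(\hat x_k^K)|=\|P_k\|_C$, where $\|\cdot\|_C$ is the uniform norm on $(0,T)$. Stop if $\|p_k\|_C\le\alpha$ and $\|P_k\|_C\le\beta$.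 Otherwise let $$\widehat u_k=\begin{cases}\dfrac{\operatorname{sign}(p_k(\hat x^S_k))}{\alpha}S_{\hat x^S_k}&\text{if }\|p_k\|_C/\alpha\ge\|P_k\|_C/\beta,\\[2mm] \dfrac{\operatorname{sign}(P_k(\hat x^K_k))}{\beta}K_{\hat x^K_k}&\text{otherwise,}\end{cases}$$ let $\mathcal A_k^+=\mathcal A_k\cup\{\widehat u_k\}$, take a minimizer $(\lambda^{k+1},\ell^{k+1})$ of $(\mathcal P(\mathcal A_k^+))$, put $u_{k+1}=\sum_{v\in\mathcal A_k^+}\lambda^{k+1}_v v+\ell^{k+1}$ and let $\mathcal A_{k+1}$ be the set of $v\in\mathcal A^+_k$ with $\lambda^{k+1}_v\neq0$. Suppose that the algorithm does not stop, and let $(u_k)_{k\ge1}$ be a sequence that it generates. Put $$\widehat r_J(u_k)=f(u_k)+\sum_{v\in\mathcal A_k}\lambda^k_v-\min_{u\in\mathrm{BV}(0,T)}J(u),\qquad \Psi(u_k)=M_0\left(\max\left\{\frac{\|p_k\|_C}{\alpha},\frac{\|P_k\|_C}{\beta}\right\}-1\right).$$ Then the minimum of $J$ over $\mathrm{BV}(0,T)$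 is attained, and for all $k\ge1$ $$J(u_k)-\min_{u\in\mathrm{BV}(0,T)}J(u)\le\widehat r_J(u_k)\le\Psi(u_k).$$ Moreover, if $C>0$ is such that $\max\{\|u_k\|_{L^2},M_0\|\widehat u_k\|_{L^2}\}\le C$ for all $k\ge1$, then for all $k\ge1$ $$J(u_k)-\min_{u\in\mathrm{BV}(0,T)}J(u)\le\widehat r_J(u_k)\le\frac{\widehat r_J(u_1)}{1+q(k-1)},\qquad q=\frac{\widehat r_J(u_1)}{8L_fC^2}.$$ In particular $\widehat r_J(u_k)=O(1/k)$ as $k\to\infty$. -/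

import Mathlib

open MeasureTheory Set Filter
open scoped ENNReal ContDiff

noncomputable section

namespace TGV

/-! ### The spaces `L²(0,T)` and `BV(0,T)`, and the total generalized variation -/

/-- The Hilbert space `L²(0,T)`. -/
abbrev L2 (T : ℝ) : Type := Lp ℝ 2 (volume.restrict (Ioo (0 : ℝ) T))

/-- `φ ∈ C_c^∞(0,T)`. -/
def IsTest (T : ℝ) (φ : ℝ → ℝ) : Prop :=
  ContDiff ℝ ∞ φ ∧ HasCompactSupport φ ∧ tsupport φ ⊆ Ioo 0 T

/-- The Radon norm `‖Λ‖_M` of a distribution `Λ` on `(0,T)`, i.e. its dual norm with respect to the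
uniform norm. It is finite if and only if `Λ` is (represented by) a finite Radon measure, an
element of `M(0,T) = C_0(0,T)^*`. -/
def radonNorm (T : ℝ) (Λ : (ℝ → ℝ) → ℝ) : ℝ≥0∞ :=
  ⨆ (φ : ℝ → ℝ) (_ : IsTest T φ) (_ : ∀ x, |φ x| ≤ 1), ENNReal.ofReal (Λ φ)

/-- The distributional derivative `Du` of a function `u` on `(0,T)`. -/
def distDeriv (T : ℝ) (u : ℝ → ℝ) (φ : ℝ → ℝ) : ℝ :=
  -∫ x in Ioo 0 T, u x * deriv φ x

/-- The distribution on `(0,T)` given by the function `w`. -/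
def distFun (T : ℝ) (w : ℝ → ℝ) (φ : ℝ → ℝ) : ℝ :=
  ∫ x in Ioo 0 T, w x * φ x

/-- `TV(u) = ‖Du‖_M`. -/
def tv (T : ℝ) (u : ℝ → ℝ) : ℝ≥0∞ := radonNorm T (distDeriv T u)

/-- `u ∈ BV(0,T)`: `u` is in `L¹(0,T)` and its distributional derivative is a finite measure.
In one dimension `BV(0,T) ⊆ L^∞(0,T) ⊆ L²(0,T)`. -/
def IsBV (T : ℝ) (u : ℝ → ℝ) : Prop :=
  IntegrableOn u (Ioo 0 T) ∧ tv T u < ⊤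

/-- `‖u‖_BV = ‖u‖_{L¹} + TV(u)`. -/
def bvNorm (T : ℝ) (u : ℝ → ℝ) : ℝ≥0∞ :=
  (∫⁻ x in Ioo 0 T, ‖u x‖ₑ) + tv T u

/-- `TGV(u) = inf_{w ∈ BV(0,T)} α ‖Du - w‖_M + β ‖Dw‖_M`. -/
def tgv (T α β : ℝ) (u : ℝ → ℝ) : ℝ≥0∞ :=
  ⨅ (w : ℝ → ℝ) (_ : IsBV T w),
    ENNReal.ofReal α * radonNorm T (distDeriv T u - distFun T w) + ENNReal.ofReal β * tv T w

/-- The set `BV(0,T)` inside `L²(0,T)`. -/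
def bvSet (T : ℝ) : Set (L2 T) := {u | IsBV T u}

/-- The objective `J(u) = f(u) + TGV(u)`, to be used for `u ∈ BV(0,T)`, where `TGV(u) < ∞`. -/
def J (T α β : ℝ) (f : L2 T → ℝ) (u : L2 T) : ℝ := f u + (tgv T α β u).toReal

/-- The value `min_{u ∈ BV(0,T)} J(u)`. -/
def minJ (T α β : ℝ) (f : L2 T → ℝ) : ℝ := sInf (J T α β f '' bvSet T)

/-! ### Affine functions and extremal points -/

/-- The space `ℒ` of affine linear functions on `(0,T)`. -/
def affineSet (T : ℝ) : Set (L2 T) :=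
  {l | ∃ c d : ℝ, l =ᵐ[volume.restrict (Ioo 0 T)] fun x => c * x + d}

/-- The jump function `S_{x₀} = 1_{(x₀,T)}`. -/
def jumpFun (T x₀ : ℝ) : ℝ → ℝ := (Ioo x₀ T).indicator fun _ => 1

/-- The kink function: `K_{x₁}(x) = 1_{(0,x₁)}(x) (x₁ - x)` if `x₁ < T/2` and
`K_{x₁}(x) = 1_{(x₁,T)}(x) (x - x₁)` otherwise. -/
def kinkFun (T x₁ : ℝ) : ℝ → ℝ :=
  if x₁ < T / 2 then (Ioo 0 x₁).indicator fun x => x₁ - x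
  else (Ioo x₁ T).indicator fun x => x - x₁

lemma memLp_jumpFun (T x₀ : ℝ) : MemLp (jumpFun T x₀) 2 (volume.restrict (Ioo 0 T)) := by
  refine MemLp.of_bound (C := 1) ?_ (ae_of_all _ fun x => ?_)
  · exact (measurable_const.indicator measurableSet_Ioo).aestronglyMeasurable
  · unfold jumpFun
    by_cases h : x ∈ Ioo x₀ T <;> simp [h]

lemma memLp_kinkFun (T x₁ : ℝ) : MemLp (kinkFun T x₁) 2 (volume.restrict (Ioo 0 T)) := by
  refine MemLp.of_bound (C := |T| + |x₁|) ?_ (ae_of_all _ fun x => ?_)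
  · unfold kinkFun
    split_ifs
    · exact ((measurable_const.sub measurable_id).indicator
        measurableSet_Ioo).aestronglyMeasurable
    · exact ((measurable_id.sub measurable_const).indicator
        measurableSet_Ioo).aestronglyMeasurable
  · have h1 := neg_abs_le x₁
    have h2 := le_abs_self x₁
    have h3 := le_abs_self T
    have h4 := abs_nonneg T
    unfold kinkFun
    split_ifs
    · by_cases h : x ∈ Ioo 0 x₁
      · rw [indicator_of_mem h, Real.norm_eq_abs, abs_le]
        constructor <;> linarith [h.1, h.2]
      · rw [indicator_of_notMem h, norm_zero]
        positivity
    · by_cases h : x ∈ Ioo x₁ T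
      · rw [indicator_of_mem h, Real.norm_eq_abs, abs_le]
        constructor <;> linarith [h.1, h.2]
      · rw [indicator_of_notMem h, norm_zero]
        positivity

/-- `S_{x₀}` as an element of `L²(0,T)`. -/
def jump (T x₀ : ℝ) : L2 T := (memLp_jumpFun T x₀).toLp

/-- `K_{x₁}` as an element of `L²(0,T)`. -/
def kink (T x₁ : ℝ) : L2 T := (memLp_kinkFun T x₁).toLp

/-- `Ext B = {± S_x / α | x ∈ (0,T)} ∪ {± K_x / β | x ∈ (β/α, T - β/α)}`. -/
def extB (T α β : ℝ) : Set (L2 T) :=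
  {v | ∃ x ∈ Ioo 0 T, v = (1 / α) • jump T x ∨ v = -((1 / α) • jump T x)} ∪
  {v | ∃ x ∈ Ioo (β / α) (T - β / α), v = (1 / β) • kink T x ∨ v = -((1 / β) • kink T x)}

/-! ### The algorithm -/

/-- The uniform norm `‖g‖_C` on `(0,T)`. -/
def supNorm (T : ℝ) (g : ℝ → ℝ) : ℝ := ⨆ x : Ioo (0 : ℝ) T, |g x|

/-- The dual variable `p(x) = ∫_0^x g(s) ds`, where `g` is the gradient of `f` at the iterate. -/
def dualp {T : ℝ} (g : L2 T) (x : ℝ) : ℝ := ∫ s in (0 : ℝ)..x, g s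

/-- The dual variable `P(x) = - ∫_0^x p(s) ds`. -/
def dualP {T : ℝ} (g : L2 T) (x : ℝ) : ℝ := -∫ s in (0 : ℝ)..x, dualp g s

/-- `max {‖p‖_C / α, ‖P‖_C / β}`. -/
def dualMax {T : ℝ} (α β : ℝ) (g : L2 T) : ℝ :=
  max (supNorm T (dualp g) / α) (supNorm T (dualP g) / β)

/-- The candidate function `û`, for given points `xS`, `xK` at which `|p|` and `|P|` are maximal. -/
def candidate {T : ℝ} (α β : ℝ) (g : L2 T) (xS xK : ℝ) : L2 T :=
  if supNorm T (dualP g) / β ≤ supNorm T (dualp g) / α then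
    (Real.sign (dualp g xS) / α) • jump T xS
  else (Real.sign (dualP g xK) / β) • kink T xK

/-- The function `∑_{v ∈ A} λ_v v + ℓ`. -/
def combine {T : ℝ} (A : Finset (L2 T)) (lam : L2 T → ℝ) (l : L2 T) : L2 T :=
  ∑ v ∈ A, lam v • v + l

/-- `(λ, ℓ)` is a minimizer of the problem
`min_{λ ≥ 0, ℓ ∈ ℒ} f (∑_{v ∈ A} λ_v v + ℓ) + ∑_{v ∈ A} λ_v`. -/
def IsSubproblemMin {T : ℝ} (f : L2 T → ℝ) (A : Finset (L2 T)) (lam : L2 T → ℝ) (l : L2 T) :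
    Prop :=
  (∀ v ∈ A, 0 ≤ lam v) ∧ l ∈ affineSet T ∧
    ∀ (lam' : L2 T → ℝ) (l' : L2 T), (∀ v ∈ A, 0 ≤ lam' v) → l' ∈ affineSet T →
      f (combine A lam l) + ∑ v ∈ A, lam v ≤ f (combine A lam' l') + ∑ v ∈ A, lam' v

open Classical in
/-- A run of the algorithm that does not terminate after finitely many iterations. The sequences
`lam`, `ell`, `u`, `xS`, `xK` matter for `k ≥ 1` only. -/
structure Run (T α β : ℝ) (f : L2 T → ℝ) where
  /-- The active sets `A_k`. -/
  A : ℕ → Finset (L2 T)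
  /-- The weights `λ^k`. -/
  lam : ℕ → L2 T → ℝ
  /-- The affine parts `ℓ^k`. -/
  ell : ℕ → L2 T
  /-- The iterates `u_k`. -/
  u : ℕ → L2 T
  /-- The points at which `|p_k|` is maximal. -/
  xS : ℕ → ℝ
  /-- The points at which `|P_k|` is maximal. -/
  xK : ℕ → ℝ
  /-- The input `A_0` is a finite subset of `Ext B`. -/
  input : ∀ v ∈ A 0, v ∈ extB T α β
  /-- Step 1: `(λ^1, ℓ^1)` solves the subproblem for `A_0`. -/
  init_min : IsSubproblemMin f (A 0) (lam 1) (ell 1)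
  init_u : u 1 = combine (A 0) (lam 1) (ell 1)
  init_A : A 1 = (A 0).filter fun v => lam 1 v ≠ 0
  /-- Step 2. -/
  xS_mem : ∀ k ≥ 1, xS k ∈ Ioo 0 T
  xS_max : ∀ k ≥ 1, |dualp (gradient f (u k)) (xS k)| = supNorm T (dualp (gradient f (u k)))
  xK_mem : ∀ k ≥ 1, xK k ∈ Ioo 0 T
  xK_max : ∀ k ≥ 1, |dualP (gradient f (u k)) (xK k)| = supNorm T (dualP (gradient f (u k)))
  /-- Step 3: the stopping criterion is never met. -/
  not_stop : ∀ k ≥ 1, ¬ (supNorm T (dualp (gradient f (u k))) ≤ α ∧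
    supNorm T (dualP (gradient f (u k))) ≤ β)
  /-- Steps 4 and 5: the candidate is inserted and the subproblem for the enlarged active set is
  solved; then the elements of weight zero are removed. -/
  step_min : ∀ k ≥ 1, IsSubproblemMin f
    (insert (candidate α β (gradient f (u k)) (xS k) (xK k)) (A k)) (lam (k + 1)) (ell (k + 1))
  step_u : ∀ k ≥ 1, u (k + 1) = combine
    (insert (candidate α β (gradient f (u k)) (xS k) (xK k)) (A k)) (lam (k + 1)) (ell (k + 1))
  step_A : ∀ k ≥ 1, A (k + 1) =
    (insert (candidate α β (gradient f (u k)) (xS k) (xK k)) (A k)).filter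
      fun v => lam (k + 1) v ≠ 0

namespace Run

variable {T α β : ℝ} {f : L2 T → ℝ}

/-- The candidate `û_k`. -/
def uhat (R : Run T α β f) (k : ℕ) : L2 T :=
  candidate α β (gradient f (R.u k)) (R.xS k) (R.xK k)

/-- The residual `r̂_J(u_k) = f(u_k) + ∑_j λ^k_j - min J`. -/
def residual (R : Run T α β f) (k : ℕ) : ℝ :=
  f (R.u k) + ∑ v ∈ R.A k, R.lam k v - minJ T α β f

/-- The constraint violation `Ψ(u_k) = M₀ (max {‖p_k‖_C / α, ‖P_k‖_C / β} - 1)`. -/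
def violation (R : Run T α β f) (M₀ : ℝ) (k : ℕ) : ℝ :=
  M₀ * (dualMax α β (gradient f (R.u k)) - 1)

end Run

end TGV

end

/-! Write g = ∇f(u_k). Optimality in the affine directions makes g orthogonal to the affine
functions, and optimality along the scalings (1+t)(λ, ℓ) gives ⟨g, u_k⟩ = -∑ λ
(`IsSubproblemMin.inner_affine_eq_zero`, `IsSubproblemMin.inner_self_eq`). Orthogonality makes g an
L² limit of second derivatives ψ'' of test functions, with p ≈ ψ' and P ≈ -ψ. Testing Du - w with ψ'
and Dw with -ψ cancels w and yields the duality estimate -⟨g, u⟩ ≤ max(‖p‖/α, ‖P‖/β) TGV(u)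
(`neg_inner_le_dualMax_mul_tgv`). The candidate has TGV at most 1 and -⟨g, û_k⟩ equals that maximum
(`inner_candidate`).

A minimizer z of J has TGV(z) ≤ M₀, since J(z) ≤ J(0) = f(0) and f ≥ -C_f. Convexity of f at u_k and
the duality estimate at z give residual ≤ Ψ. By sublinearity ∑ λ bounds TGV(u_k), so J(u_k) - min J
≤ residual.

For the rate, the next subproblem is compared with u_k + s(M₀ û_k - u_k). The first-order change of
the objective is exactly -sΨ(u_k), and the Lipschitz gradient bounds the rest, so r_{k+1} ≤ r_k - s
r_k + 2 L_f C² s² for s in [0,1] (`residual_succ_le`). A good s gives 1/r_{k+1} ≥ 1/r_k + 1/(8 L_f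
C²) (`le_div_of_descent`).

Existence of the minimizer is the direct method for the pair (u, w): near-optimal w are bounded in
L² by the embedding of BV, and the constraints pass to weak limits test function by test function
(`exists_minimizer`). -/

namespace TGV

open scoped Topology RealInnerProductSpace

/-! ### Test functions on (0,T) and their antiderivatives -/

section Tests

variable {T : ℝ}

/-- An enclosing interval is easier to combine than `tsupport`. It may be empty: a ≤ b is not
required, so the zero function qualifies for every T. -/
lemma isTest_iff {φ : ℝ → ℝ} :
    IsTest T φ ↔ ContDiff ℝ ∞ φ ∧ ∃ a b, 0 < a ∧ b < T ∧ ∀ x ∉ Icc a b, φ x = 0 := by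
  constructor
  · rintro ⟨h1, h2, h3⟩
    refine ⟨h1, ?_⟩
    rcases (tsupport φ).eq_empty_or_nonempty with h | h
    · refine ⟨1, T - 1, one_pos, by linarith, fun x _ => ?_⟩
      rw [tsupport_eq_empty_iff] at h
      simp [h]
    · have hc : IsCompact (tsupport φ) := h2
      refine ⟨sInf (tsupport φ), sSup (tsupport φ), (h3 (hc.sInf_mem h)).1,
        (h3 (hc.sSup_mem h)).2, fun x hx => ?_⟩
      apply image_eq_zero_of_notMem_tsupport
      exact fun hm => hx ⟨csInf_le hc.bddBelow hm, le_csSup hc.bddAbove hm⟩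
  · rintro ⟨h1, a, b, ha, hb, h⟩
    have hs : tsupport φ ⊆ Icc a b := by
      refine closure_minimal (fun x hx => ?_) isClosed_Icc
      by_contra hc
      exact hx (h x hc)
    exact ⟨h1, isCompact_Icc.of_isClosed_subset (isClosed_tsupport _) hs,
      hs.trans fun x hx => ⟨ha.trans_le hx.1, hx.2.trans_lt hb⟩⟩

namespace IsTest

lemma zero : IsTest T (fun _ => 0) :=
  isTest_iff.2 ⟨contDiff_const, 1, T - 1, one_pos, by linarith, fun _ _ => rfl⟩

variable {φ ψ : ℝ → ℝ}

lemma smul (h : IsTest T φ) (c : ℝ) : IsTest T (fun x => c * φ x) := by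
  obtain ⟨h1, a, b, ha, hb, h0⟩ := isTest_iff.1 h
  exact isTest_iff.2 ⟨contDiff_const.mul h1, a, b, ha, hb, fun x hx => by simp [h0 x hx]⟩

lemma neg (h : IsTest T φ) : IsTest T (fun x => -φ x) := by
  simpa using h.smul (-1)

lemma add (h : IsTest T φ) (h' : IsTest T ψ) : IsTest T (fun x => φ x + ψ x) := by
  obtain ⟨h1, a, b, ha, hb, h0⟩ := isTest_iff.1 h
  obtain ⟨h1', a', b', ha', hb', h0'⟩ := isTest_iff.1 h'
  refine isTest_iff.2 ⟨h1.add h1', min a a', max b b', lt_min ha ha', max_lt hb hb',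
    fun x hx => ?_⟩
  rw [h0 x fun h => hx ⟨(min_le_left _ _).trans h.1, h.2.trans (le_max_left _ _)⟩,
    h0' x fun h => hx ⟨(min_le_right _ _).trans h.1, h.2.trans (le_max_right _ _)⟩, add_zero]

lemma sub (h : IsTest T φ) (h' : IsTest T ψ) : IsTest T (fun x => φ x - ψ x) := by
  simpa [sub_eq_add_neg] using h.add h'.neg

lemma deriv (h : IsTest T φ) : IsTest T (deriv φ) := by
  refine ⟨(contDiff_infty_iff_deriv.1 h.1).2, h.2.1.deriv, ?_⟩
  exact (closure_minimal (support_deriv_subset) isClosed_closure).trans h.2.2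

lemma continuous (h : IsTest T φ) : Continuous φ := h.1.continuous

lemma differentiable (h : IsTest T φ) : Differentiable ℝ φ := h.1.differentiable (by simp)

lemma eq_zero (h : IsTest T φ) {x : ℝ} (hx : x ∉ Ioo 0 T) : φ x = 0 := by
  apply image_eq_zero_of_notMem_tsupport
  exact fun hm => hx (h.2.2 hm)

lemma exists_bound (h : IsTest T φ) : ∃ M, 0 ≤ M ∧ ∀ x, |φ x| ≤ M := by
  obtain ⟨M, hM⟩ := h.2.1.exists_bound_of_continuous h.continuous
  exact ⟨M, (norm_nonneg _).trans (hM 0), hM⟩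

lemma memLp (h : IsTest T φ) (p : ℝ≥0∞) : MemLp φ p (volume.restrict (Ioo 0 T)) := by
  obtain ⟨M, -, hM⟩ := h.exists_bound
  exact MemLp.of_bound h.continuous.aestronglyMeasurable M (ae_of_all _ hM)

lemma integrable (h : IsTest T φ) : IntegrableOn φ (Ioo 0 T) :=
  memLp_one_iff_integrable.1 (h.memLp 1)

lemma integrable_mul {u : ℝ → ℝ} (h : IsTest T φ) (hu : IntegrableOn u (Ioo 0 T)) :
    IntegrableOn (fun x => u x * φ x) (Ioo 0 T) := by
  obtain ⟨M, -, hM⟩ := h.exists_bound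
  exact Integrable.mul_bdd hu h.continuous.aestronglyMeasurable (ae_of_all _ hM)

end IsTest

lemma setIntegral_Ioo_eq {a b : ℝ} (h : a ≤ b) (u : ℝ → ℝ) :
    ∫ x in Ioo a b, u x = ∫ x in a..b, u x := by
  rw [intervalIntegral.integral_of_le h, integral_Ioc_eq_integral_Ioo]

/-- A test function of mean zero is the derivative of a test function. -/
lemma IsTest.exists_antideriv (hT : 0 < T) {h : ℝ → ℝ} (hh : IsTest T h)
    (h0 : ∫ x in Ioo 0 T, h x = 0) :
    ∃ φ, IsTest T φ ∧ _root_.deriv φ = h ∧ ∀ x, |φ x| ≤ ∫ x in Ioo 0 T, |h x| := by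
  have hd : ∀ x, HasDerivAt (fun x => ∫ s in (0 : ℝ)..x, h s) (h x) x := fun x =>
    intervalIntegral.integral_hasDerivAt_right (hh.continuous.intervalIntegrable _ _)
      (hh.continuous.stronglyMeasurableAtFilter _ _) hh.continuous.continuousAt
  have hd' : _root_.deriv (fun x => ∫ s in (0 : ℝ)..x, h s) = h := funext fun x => (hd x).deriv
  have ht : IsTest T fun x => ∫ s in (0 : ℝ)..x, h s := by
    obtain ⟨h1, a, b, ha, hb, hz⟩ := isTest_iff.1 hh
    refine isTest_iff.2 ⟨contDiff_infty_iff_deriv.2 ⟨fun x => (hd x).differentiableAt, ?_⟩,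
      a, b, ha, hb, fun x hx => ?_⟩
    · rw [hd']; exact h1
    · rw [setIntegral_Ioo_eq hT.le] at h0
      by_cases hxa : x < a
      · have : ∫ s in (0 : ℝ)..x, h s = ∫ s in (0 : ℝ)..x, (0 : ℝ) := by
          refine intervalIntegral.integral_congr fun s hs => hz s fun hs' => ?_
          have := hs.2.trans (max_le ha.le hxa.le)
          have h3 : max 0 x < a := max_lt ha hxa
          linarith [hs.2, hs'.1]
        simpa using this
      · have hxb : b < x := by
          by_contra hc
          exact hx ⟨not_lt.1 hxa, not_lt.1 hc⟩
        have h2 : ∫ s in x..T, h s = ∫ s in x..T, (0 : ℝ) := by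
          refine intervalIntegral.integral_congr fun s hs => hz s fun hs' => ?_
          have h3 : b < min x T := lt_min hxb hb
          linarith [hs.1, hs'.2]
        have h3 := intervalIntegral.integral_add_adjacent_intervals
          (hh.continuous.intervalIntegrable (μ := volume) 0 x)
          (hh.continuous.intervalIntegrable x T)
        rw [h2, h0] at h3
        simpa using h3
  refine ⟨_, ht, hd', fun x => ?_⟩
  by_cases hx : x ∈ Ioo 0 T
  · rw [setIntegral_Ioo_eq hT.le]
    refine (intervalIntegral.abs_integral_le_integral_abs hx.1.le).trans ?_
    exact intervalIntegral.integral_mono_interval le_rfl hx.1.le hx.2.le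
      (ae_of_all _ fun s => abs_nonneg _) (hh.continuous.abs.intervalIntegrable _ _)
  · rw [ht.eq_zero hx, abs_zero]
    exact integral_nonneg fun _ => abs_nonneg _

lemma exists_isTest_integral_eq_one (hT : 0 < T) :
    ∃ η, IsTest T η ∧ ∫ x in Ioo 0 T, η x = 1 := by
  let B : ContDiffBump (T / 2) := ⟨T / 8, T / 4, by positivity, by linarith⟩
  have hB : IsTest T (B.normed volume) := by
    refine ⟨B.contDiff_normed, B.hasCompactSupport_normed, ?_⟩
    rw [B.tsupport_normed_eq, Real.closedBall_eq_Icc]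
    intro x hx
    have h1 : T / 2 - T / 4 ≤ x := hx.1
    have h2 : x ≤ T / 2 + T / 4 := hx.2
    constructor <;> linarith
  refine ⟨_, hB, ?_⟩
  rw [setIntegral_eq_integral_of_forall_compl_eq_zero fun x hx => hB.eq_zero hx]
  exact B.integral_normed

lemma integral_deriv_mul_eq_neg (hT : 0 < T) {φ ψ : ℝ → ℝ} (hφ : IsTest T φ) (hψ : ContDiff ℝ ∞ ψ) :
    ∫ x in Ioo 0 T, ψ x * deriv φ x = -∫ x in Ioo 0 T, deriv ψ x * φ x := by
  rw [setIntegral_Ioo_eq hT.le, setIntegral_Ioo_eq hT.le]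
  have hψ' : Continuous (deriv ψ) := (contDiff_infty_iff_deriv.1 hψ).2.continuous
  rw [intervalIntegral.integral_mul_deriv_eq_deriv_mul
    (fun x _ => ((hψ.differentiable (by simp)) x).hasDerivAt)
    (fun x _ => (hφ.differentiable x).hasDerivAt) (hψ'.intervalIntegrable _ _)
    (hφ.deriv.continuous.intervalIntegrable _ _)]
  rw [hφ.eq_zero (x := T) (by simp), hφ.eq_zero (x := 0) (by simp)]
  simp

end Tests

/-! ### Distributions, the embedding of BV into L², and functions with vanishing second derivative
-/

section Radon

variable {T : ℝ}

lemma radonNorm_le {Λ : (ℝ → ℝ) → ℝ} {M : ℝ}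
    (h : ∀ φ, IsTest T φ → (∀ x, |φ x| ≤ 1) → Λ φ ≤ M) : radonNorm T Λ ≤ ENNReal.ofReal M :=
  iSup_le fun φ => iSup_le fun h1 => iSup_le fun h2 => ENNReal.ofReal_le_ofReal (h φ h1 h2)

lemma le_radonNorm (Λ : (ℝ → ℝ) → ℝ) {φ : ℝ → ℝ} (h1 : IsTest T φ) (h2 : ∀ x, |φ x| ≤ 1) :
    ENNReal.ofReal (Λ φ) ≤ radonNorm T Λ :=
  le_iSup_of_le φ <| le_iSup_of_le h1 <| le_iSup_of_le h2 le_rfl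

lemma apply_le_of_radonNorm_le {Λ : (ℝ → ℝ) → ℝ} {M : ℝ} (hM : 0 ≤ M)
    (h : radonNorm T Λ ≤ ENNReal.ofReal M) {φ : ℝ → ℝ} (h1 : IsTest T φ) (h2 : ∀ x, |φ x| ≤ 1) :
    Λ φ ≤ M :=
  (ENNReal.ofReal_le_ofReal_iff hM).1 ((le_radonNorm Λ h1 h2).trans h)

/-- Homogeneity rescales φ to the unit ball; c = 0 is separate because it forces φ = 0. -/
lemma apply_le_mul_of_radonNorm_le {Λ : (ℝ → ℝ) → ℝ}
    (hΛ : ∀ (c : ℝ) (φ : ℝ → ℝ), Λ (fun x => c * φ x) = c * Λ φ) {M : ℝ} (hM : 0 ≤ M)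
    (h : radonNorm T Λ ≤ ENNReal.ofReal M) {φ : ℝ → ℝ} (h1 : IsTest T φ) {c : ℝ}
    (h2 : ∀ x, |φ x| ≤ c) : Λ φ ≤ c * M := by
  have hc : 0 ≤ c := (abs_nonneg _).trans (h2 0)
  rcases hc.eq_or_lt with rfl | hc
  · have h3 : φ = fun x => 0 * φ x := by
      funext x
      rw [zero_mul]
      exact abs_eq_zero.1 (le_antisymm (h2 x) (abs_nonneg _))
    rw [h3, hΛ]; simp
  · have h3 := apply_le_of_radonNorm_le hM h (h1.smul c⁻¹) fun x => by
      rw [abs_mul, abs_of_pos (inv_pos.2 hc), inv_mul_le_iff₀ hc, mul_one]; exact h2 x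
    rwa [hΛ, inv_mul_le_iff₀ hc] at h3

lemma distDeriv_smul (u : ℝ → ℝ) (c : ℝ) (φ : ℝ → ℝ) :
    distDeriv T u (fun x => c * φ x) = c * distDeriv T u φ := by
  simp only [distDeriv, deriv_const_mul_field, mul_left_comm _ c, integral_const_mul, mul_neg]

lemma distFun_smul (u : ℝ → ℝ) (c : ℝ) (φ : ℝ → ℝ) :
    distFun T u (fun x => c * φ x) = c * distFun T u φ := by
  simp only [distFun, mul_left_comm _ c, integral_const_mul]

lemma distDeriv_sub_distFun_smul (u w : ℝ → ℝ) (c : ℝ) (φ : ℝ → ℝ) :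
    (distDeriv T u - distFun T w) (fun x => c * φ x) = c * (distDeriv T u - distFun T w) φ := by
  simp only [Pi.sub_apply, distDeriv_smul, distFun_smul, mul_sub]

lemma distDeriv_congr {u v : ℝ → ℝ} (h : u =ᵐ[volume.restrict (Ioo 0 T)] v) :
    distDeriv T u = distDeriv T v := by
  funext φ
  refine congrArg _ (integral_congr_ae ?_)
  filter_upwards [h] with x hx
  rw [hx]

lemma distFun_congr {u v : ℝ → ℝ} (h : u =ᵐ[volume.restrict (Ioo 0 T)] v) :
    distFun T u = distFun T v := by
  funext φ
  refine integral_congr_ae ?_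
  filter_upwards [h] with x hx
  rw [hx]

lemma isBV_congr {u v : ℝ → ℝ} (h : u =ᵐ[volume.restrict (Ioo 0 T)] v) :
    IsBV T u ↔ IsBV T v := by
  simp only [IsBV, tv, distDeriv_congr h, IntegrableOn, integrable_congr h]

lemma tgv_congr {α β : ℝ} {u v : ℝ → ℝ} (h : u =ᵐ[volume.restrict (Ioo 0 T)] v) :
    tgv T α β u = tgv T α β v := by
  simp only [tgv, distDeriv_congr h]

lemma L2.integrable (u : L2 T) : IntegrableOn u (Ioo 0 T) :=
  (Lp.memLp u).integrable one_le_two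

lemma L2.inner_eq (u v : L2 T) : ⟪u, v⟫ = ∫ x in Ioo 0 T, u x * v x := by
  rw [MeasureTheory.L2.inner_def]
  simp [mul_comm]

/-- The class of a test function in `L²(0,T)`. -/
noncomputable def IsTest.toL2 {φ : ℝ → ℝ} (h : IsTest T φ) : L2 T := (h.memLp 2).toLp

lemma IsTest.coeFn_toL2 {φ : ℝ → ℝ} (h : IsTest T φ) :
    h.toL2 =ᵐ[volume.restrict (Ioo 0 T)] φ := MemLp.coeFn_toLp _

lemma inner_toL2 (u : L2 T) {φ : ℝ → ℝ} (h : IsTest T φ) :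
    ⟪u, h.toL2⟫ = ∫ x in Ioo 0 T, u x * φ x := by
  rw [L2.inner_eq]
  refine integral_congr_ae ?_
  filter_upwards [h.coeFn_toL2] with x hx
  rw [hx]

lemma distFun_eq_inner (u : L2 T) {φ : ℝ → ℝ} (h : IsTest T φ) :
    distFun T u φ = ⟪u, h.toL2⟫ := (inner_toL2 u h).symm

lemma distDeriv_eq_inner (u : L2 T) {φ : ℝ → ℝ} (h : IsTest T φ) :
    distDeriv T u φ = -⟪u, h.deriv.toL2⟫ := by rw [inner_toL2]; rfl

/-- The constant function `1`. -/
noncomputable def oneL2 (T : ℝ) : L2 T := (memLp_const (1 : ℝ)).toLp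

lemma coeFn_oneL2 : oneL2 T =ᵐ[volume.restrict (Ioo 0 T)] fun _ => 1 := MemLp.coeFn_toLp _

lemma integral_abs_le (v : L2 T) : ∫ x in Ioo 0 T, |v x| ≤ ‖oneL2 T‖ * ‖v‖ := by
  have h : ∫ x in Ioo 0 T, |v x| = ⟪oneL2 T, |v|⟫ := by
    rw [L2.inner_eq]
    refine integral_congr_ae ?_
    filter_upwards [coeFn_oneL2 (T := T), Lp.coeFn_abs v] with x h1 h2
    rw [h1, h2, one_mul]
  rw [h]
  exact (real_inner_le_norm _ _).trans_eq (by rw [norm_abs_eq_norm])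

lemma integral_abs_le_of_ae_eq {φ : ℝ → ℝ} {v : L2 T}
    (hv : v =ᵐ[volume.restrict (Ioo 0 T)] φ) : ∫ x in Ioo 0 T, |φ x| ≤ ‖oneL2 T‖ * ‖v‖ := by
  refine le_trans (le_of_eq ?_) (integral_abs_le v)
  refine integral_congr_ae ?_
  filter_upwards [hv] with x hx
  rw [hx]

lemma ae_eq_zero_of_distFun {w : ℝ → ℝ} (hw : IntegrableOn w (Ioo 0 T))
    (h : ∀ φ, IsTest T φ → ∫ x in Ioo 0 T, w x * φ x = 0) :
    w =ᵐ[volume.restrict (Ioo 0 T)] 0 := by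
  have := isOpen_Ioo.ae_eq_zero_of_integral_contDiff_smul_eq_zero (U := Ioo 0 T) (μ := volume)
    (f := w) hw.locallyIntegrableOn fun g h1 h2 h3 => by
      have hg : IsTest T g := ⟨h1, h2, h3⟩
      rw [← setIntegral_eq_integral_of_forall_compl_eq_zero (s := Ioo 0 T)
        fun x hx => by rw [hg.eq_zero hx, zero_smul]]
      simpa only [smul_eq_mul, mul_comm] using h g hg
  exact (ae_restrict_iff' measurableSet_Ioo).2 this

/-- The subspace of test functions of `L²(0,T)`. -/
def testSubmodule (T : ℝ) : Submodule ℝ (L2 T) where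
  carrier := {v | ∃ φ, IsTest T φ ∧ v =ᵐ[volume.restrict (Ioo 0 T)] φ}
  add_mem' := by
    rintro v v' ⟨φ, h, hv⟩ ⟨φ', h', hv'⟩
    exact ⟨_, h.add h', (Lp.coeFn_add v v').trans (hv.add hv')⟩
  zero_mem' := ⟨_, IsTest.zero, Lp.coeFn_zero _ _ _⟩
  smul_mem' := by
    rintro c v ⟨φ, h, hv⟩
    exact ⟨_, h.smul c, (Lp.coeFn_smul c v).trans (hv.const_smul c)⟩

/-- An integrable function that is bounded in `L²` as a distribution is in `L²`. -/
lemma exists_L2_of_bound {w : ℝ → ℝ} (hw : IntegrableOn w (Ioo 0 T)) {K : ℝ} (hK : 0 ≤ K)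
    (h : ∀ φ (hφ : IsTest T φ) (v : L2 T), v =ᵐ[volume.restrict (Ioo 0 T)] φ →
      distFun T w φ ≤ K * ‖v‖) :
    ∃ W : L2 T, W =ᵐ[volume.restrict (Ioo 0 T)] w ∧ ‖W‖ ≤ K := by
  have hcongr : ∀ {v : L2 T} {φ : ℝ → ℝ}, v =ᵐ[volume.restrict (Ioo 0 T)] φ →
      (fun x => w x * v x) =ᵐ[volume.restrict (Ioo 0 T)] fun x => w x * φ x := by
    intro v φ hv
    filter_upwards [hv] with x hx
    rw [hx]
  have hint : ∀ v ∈ testSubmodule T, IntegrableOn (fun x => w x * v x) (Ioo 0 T) := by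
    rintro v ⟨φ, hφ, hv⟩
    exact (integrable_congr (hcongr hv)).2 (hφ.integrable_mul hw)
  let F : testSubmodule T →ₗ[ℝ] ℝ :=
    { toFun := fun v => ∫ x in Ioo 0 T, w x * (v : L2 T) x
      map_add' := by
        intro v v'
        rw [← integral_add (hint v v.2) (hint v' v'.2)]
        refine integral_congr_ae ?_
        filter_upwards [Lp.coeFn_add (v : L2 T) v'] with x hx
        rw [Submodule.coe_add, hx, Pi.add_apply, mul_add]
      map_smul' := by
        intro c v
        rw [RingHom.id_apply, smul_eq_mul, ← integral_const_mul]
        refine integral_congr_ae ?_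
        filter_upwards [Lp.coeFn_smul c (v : L2 T)] with x hx
        rw [Submodule.coe_smul, hx, Pi.smul_apply, smul_eq_mul, mul_left_comm] }
  have hF : ∀ v, ‖F v‖ ≤ K * ‖v‖ := by
    rintro ⟨v, φ, hφ, hv⟩
    have h1 : F ⟨v, φ, hφ, hv⟩ = distFun T w φ := integral_congr_ae (hcongr hv)
    rw [h1, Real.norm_eq_abs, abs_le']
    refine ⟨h φ hφ v hv, ?_⟩
    have h2 := h _ hφ.neg (-v) ((Lp.coeFn_neg v).trans hv.neg)
    have h3 := distFun_smul (T := T) w (-1) φ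
    simp only [neg_one_mul] at h3
    rwa [h3, norm_neg] at h2
  -- Hahn–Banach extends the functional from the test functions to L² with the same norm, and Riesz
  -- represents it. The representative agrees with w on test functions, hence almost everywhere.
  obtain ⟨G, hG, hGn⟩ := exists_extension_norm_eq (𝕜 := ℝ) (testSubmodule T) (F.mkContinuous K hF)
  refine ⟨(InnerProductSpace.toDual ℝ (L2 T)).symm G, ?_, ?_⟩
  · have h0 : (fun x => ((InnerProductSpace.toDual ℝ (L2 T)).symm G) x - w x)
        =ᵐ[volume.restrict (Ioo 0 T)] 0 := by
      refine ae_eq_zero_of_distFun ((L2.integrable _).sub hw) fun φ hφ => ?_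
      simp only [sub_mul]
      rw [integral_sub (hφ.integrable_mul (L2.integrable _)) (hφ.integrable_mul hw),
        ← inner_toL2 _ hφ, InnerProductSpace.toDual_symm_apply]
      have := hG ⟨hφ.toL2, φ, hφ, hφ.coeFn_toL2⟩
      rw [this, sub_eq_zero]
      exact integral_congr_ae (hcongr hφ.coeFn_toL2)
    filter_upwards [h0] with x hx
    exact sub_eq_zero.1 hx
  · rw [LinearIsometryEquiv.norm_map, hGn]
    exact LinearMap.mkContinuous_norm_le _ hK _

/-- `BV(0,T)` embeds into `L²(0,T)`. -/
lemma exists_embedding_const (hT : 0 < T) : ∃ C, 0 ≤ C ∧ ∀ w : ℝ → ℝ, IntegrableOn w (Ioo 0 T) →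
    ∀ M, 0 ≤ M → radonNorm T (distFun T w) ≤ ENNReal.ofReal M → tv T w ≤ ENNReal.ofReal M →
    ∃ W : L2 T, W =ᵐ[volume.restrict (Ioo 0 T)] w ∧ ‖W‖ ≤ C * M := by
  obtain ⟨η, hη, hη1⟩ := exists_isTest_integral_eq_one hT
  obtain ⟨B, hB0, hB⟩ := hη.exists_bound
  set N := ∫ x in Ioo 0 T, |η x| with hN
  have hN0 : 0 ≤ N := integral_nonneg fun _ => abs_nonneg _
  -- Split h = mη + (h - mη), where m is the mean integral of h and h - mη = φ'. The first part
  -- costs at most I·B·M through the norm of w, the second I(1+N)·M through its total variation, and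
  -- I = ‖h‖_{L¹} is at most ‖1‖‖h‖ in L².
  refine ⟨(B + (1 + N)) * ‖oneL2 T‖, by positivity, fun w hw M hM h1 h2 => ?_⟩
  refine exists_L2_of_bound hw (by positivity) fun h hh v hv => ?_
  have hI := integral_abs_le_of_ae_eq hv
  set I := ∫ x in Ioo 0 T, |h x| with hIdef
  have hI0 : 0 ≤ I := integral_nonneg fun _ => abs_nonneg _
  set m := ∫ x in Ioo 0 T, h x with hm
  have hmI : |m| ≤ I := abs_integral_le_integral_abs
  have htest : IsTest T fun x => h x - m * η x := hh.sub (hη.smul m)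
  obtain ⟨φ, hφ, hφd, hφb⟩ := htest.exists_antideriv hT (by
    rw [integral_sub hh.integrable (hη.smul m).integrable, integral_const_mul, hη1]; simp [hm])
  have hb : ∫ x in Ioo 0 T, |h x - m * η x| ≤ I * (1 + N) := by
    calc ∫ x in Ioo 0 T, |h x - m * η x| ≤ ∫ x in Ioo 0 T, (|h x| + |m| * |η x|) := by
          refine integral_mono htest.integrable.abs
            (hh.integrable.abs.add (hη.integrable.abs.const_mul _)) fun x => ?_
          simpa [abs_mul] using abs_sub (h x) (m * η x)
      _ = I + |m| * N := by
          rw [integral_add hh.integrable.abs (hη.integrable.abs.const_mul _), integral_const_mul]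
      _ ≤ I * (1 + N) := by nlinarith
  have e1 : distFun T w h = distFun T w (fun x => m * η x) + distDeriv T w (fun x => -φ x) := by
    have : deriv (fun x => -φ x) = fun x => -(h x - m * η x) := by
      funext x
      rw [deriv.fun_neg, hφd]
    simp only [distFun, distDeriv, this]
    simp only [mul_neg, integral_neg, neg_neg]
    rw [← integral_add ((hη.smul m).integrable_mul hw) (htest.integrable_mul hw)]
    congr 1
    funext x
    ring
  have b1 : distFun T w (fun x => m * η x) ≤ (I * B) * M :=
    apply_le_mul_of_radonNorm_le (distFun_smul w) hM h1 (hη.smul m) fun x => by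
      rw [abs_mul]
      exact mul_le_mul hmI (hB x) (abs_nonneg _) hI0
  have b2 : distDeriv T w (fun x => -φ x) ≤ (I * (1 + N)) * M :=
    apply_le_mul_of_radonNorm_le (distDeriv_smul w) hM h2 hφ.neg fun x => by
      rw [abs_neg]
      exact (hφb x).trans hb
  calc distFun T w h ≤ ((B + (1 + N)) * M) * I := by rw [e1]; linarith
    _ ≤ ((B + (1 + N)) * M) * (‖oneL2 T‖ * ‖v‖) := by gcongr
    _ = _ := by ring

/-- The second derivatives of test functions. -/
def testDerivSubmodule (T : ℝ) : Submodule ℝ (L2 T) where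
  carrier := {v | ∃ φ, IsTest T φ ∧ v =ᵐ[volume.restrict (Ioo 0 T)] deriv (deriv φ)}
  add_mem' := by
    rintro v v' ⟨φ, h, hv⟩ ⟨φ', h', hv'⟩
    refine ⟨_, h.add h', (Lp.coeFn_add v v').trans ((hv.add hv').trans (ae_of_all _ fun x => ?_))⟩
    have h1 : deriv (fun x => φ x + φ' x) = fun x => deriv φ x + deriv φ' x := by
      funext y
      exact deriv_fun_add (h.differentiable y) (h'.differentiable y)
    rw [h1]
    exact (deriv_fun_add (h.deriv.differentiable x) (h'.deriv.differentiable x)).symm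
  zero_mem' := ⟨_, IsTest.zero, by
    simp only [deriv_const']
    exact Lp.coeFn_zero _ _ _⟩
  smul_mem' := by
    rintro c v ⟨φ, h, hv⟩
    refine ⟨_, h.smul c, (Lp.coeFn_smul c v).trans ((hv.const_smul c).trans
      (ae_of_all _ fun x => ?_))⟩
    have h1 : deriv (fun x => c * φ x) = fun x => c * deriv φ x := by
      funext y
      exact deriv_const_mul_field c
    rw [h1]
    exact (deriv_const_mul_field c).symm

lemma integral_linear_combination {μ : Measure ℝ} {f g h : ℝ → ℝ} (hf : Integrable f μ)
    (hg : Integrable g μ) (hh : Integrable h μ) (m n : ℝ) :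
    ∫ x, (f x + m * g x + n * h x) ∂μ = ∫ x, f x ∂μ + m * ∫ x, g x ∂μ + n * ∫ x, h x ∂μ := by
  have hfg : Integrable (fun x => f x + m * g x) μ := hf.add (hg.const_mul m)
  rw [integral_add hfg (hh.const_mul n), integral_add hf (hg.const_mul m),
    integral_const_mul, integral_const_mul]

lemma affine_memLp (c d : ℝ) :
    MemLp (fun x => c * x + d) 2 (volume.restrict (Ioo (0 : ℝ) T)) := by
  refine MemLp.of_bound (C := |c| * |T| + |d|) (by fun_prop) ?_
  filter_upwards [ae_restrict_mem measurableSet_Ioo] with x hx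
  rw [Real.norm_eq_abs]
  refine (abs_add_le _ _).trans ?_
  rw [abs_mul]
  have : |x| ≤ |T| := abs_le_abs_of_nonneg hx.1.le hx.2.le
  gcongr

/-- A function whose second distributional derivative vanishes is affine. -/
lemma mem_affineSet_of_mem_orthogonal (hT : 0 < T) {v : L2 T}
    (hv : v ∈ (testDerivSubmodule T)ᗮ) : v ∈ affineSet T := by
  obtain ⟨η, hη, hη1⟩ := exists_isTest_integral_eq_one hT
  have hid : ContDiff ℝ ∞ fun x : ℝ => x := contDiff_id
  set a := ∫ x in Ioo 0 T, v x * η x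
  set b := ∫ x in Ioo 0 T, v x * deriv η x
  set c := ∫ x in Ioo 0 T, x * η x
  -- Removing means twice writes h - mη - nη' = ψ'', so ∫vh = ma + nb. Integration by parts against
  -- x gives n = -∫xh + mc, and collecting terms leaves ∫vh = ∫(a + bc - bx)h.
  refine ⟨-b, a + b * c, ?_⟩
  have hmul : ∀ {h : ℝ → ℝ}, IsTest T h → IntegrableOn (fun x => x * h x) (Ioo 0 T) := fun hh =>
    hh.integrable_mul ((continuous_id.integrableOn_Icc (a := 0) (b := T)).mono_set Ioo_subset_Icc_self)
  have h0 : (fun x => v x - (-b * x + (a + b * c))) =ᵐ[volume.restrict (Ioo 0 T)] 0 := by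
    refine ae_eq_zero_of_distFun ((L2.integrable v).sub
      ((affine_memLp _ _).integrable one_le_two)) fun h hh => ?_
    set m := ∫ x in Ioo 0 T, h x with hm
    have ht : IsTest T fun x => h x - m * η x := hh.sub (hη.smul m)
    obtain ⟨φ, hφ, hφd, -⟩ := ht.exists_antideriv hT (by
      rw [integral_sub hh.integrable (hη.smul m).integrable, integral_const_mul, hη1]; simp [hm])
    set n := ∫ x in Ioo 0 T, φ x with hn
    have ht' : IsTest T fun x => φ x - n * η x := hφ.sub (hη.smul n)
    obtain ⟨ψ, hψ, hψd, -⟩ := ht'.exists_antideriv hT (by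
      rw [integral_sub hφ.integrable (hη.smul n).integrable, integral_const_mul, hη1]; simp [hn])
    have hn' : n = -(∫ x in Ioo 0 T, x * h x) + m * c := by
      have h1 := integral_deriv_mul_eq_neg hT hφ hid
      simp only [deriv_id'', one_mul] at h1
      rw [hφd] at h1
      have h2 : ∫ x in Ioo 0 T, x * (h x - m * η x) = (∫ x in Ioo 0 T, x * h x) - m * c := by
        rw [← integral_const_mul, ← integral_sub (hmul hh) ((hmul hη).const_mul m)]
        congr 1
        funext x
        ring
      linarith
    have hd2 : deriv (deriv ψ) = fun x => h x - m * η x - n * deriv η x := by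
      funext x
      rw [hψd, deriv_fun_sub (hφ.differentiable x) ((hη.smul n).differentiable x), hφd,
        deriv_const_mul_field]
    have h1 : ⟪v, hψ.deriv.deriv.toL2⟫ = 0 := by
      rw [real_inner_comm]
      exact hv _ ⟨ψ, hψ, hψ.deriv.deriv.coeFn_toL2⟩
    rw [inner_toL2, hd2] at h1
    have hvi := L2.integrable v
    have h2 : ∫ x in Ioo 0 T, v x * (h x - m * η x - n * deriv η x)
        = (∫ x in Ioo 0 T, v x * h x) - m * a - n * b := by
      rw [sub_eq_add_neg, sub_eq_add_neg, ← neg_mul, ← neg_mul, ← integral_linear_combination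
        (hh.integrable_mul hvi) (hη.integrable_mul hvi) (hη.deriv.integrable_mul hvi)]
      congr 1
      funext x
      ring
    have h3 : ∫ x in Ioo 0 T, (v x - (-b * x + (a + b * c))) * h x
        = (∫ x in Ioo 0 T, v x * h x) + b * (∫ x in Ioo 0 T, x * h x) - (a + b * c) * m := by
      rw [sub_eq_add_neg, ← neg_mul, hm, ← integral_linear_combination
        (hh.integrable_mul hvi) (hmul hh) hh.integrable]
      congr 1
      funext x
      ring
    rw [h3]
    rw [h2, hn'] at h1
    linarith
  filter_upwards [h0] with x hx
  exact sub_eq_zero.1 hx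

/-- Everything orthogonal to the second derivatives is affine, so g lies in their double orthogonal
complement, which is the closure. -/
lemma mem_closure_testDeriv (hT : 0 < T) {g : L2 T} (hg : ∀ l ∈ affineSet T, ⟪g, l⟫ = 0) :
    g ∈ (testDerivSubmodule T).topologicalClosure := by
  rw [← Submodule.orthogonal_orthogonal_eq_closure, Submodule.mem_orthogonal]
  intro v hv
  rw [real_inner_comm]
  exact hg v (mem_affineSet_of_mem_orthogonal hT hv)

end Radon

/-! ### The dual variables p and P, and the duality estimate for TGV -/

section Dual

variable {T : ℝ}

lemma L2.intervalIntegrable (g : L2 T) {a b : ℝ} (ha : 0 ≤ a) (hab : a ≤ b) (hb : b ≤ T) :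
    IntervalIntegrable g volume a b := by
  rw [intervalIntegrable_iff_integrableOn_Ioo_of_le hab]
  exact (L2.integrable g).mono_set (Ioo_subset_Ioo ha hb)

lemma abs_dualp_le (g : L2 T) {x : ℝ} (h0 : 0 ≤ x) (hx : x ≤ T) :
    |dualp g x| ≤ ‖oneL2 T‖ * ‖g‖ := by
  refine le_trans ?_ (integral_abs_le g)
  rw [setIntegral_Ioo_eq (h0.trans hx)]
  refine (intervalIntegral.abs_integral_le_integral_abs h0).trans ?_
  exact intervalIntegral.integral_mono_interval le_rfl h0 hx
    (ae_of_all _ fun s => abs_nonneg _) (L2.intervalIntegrable g le_rfl (h0.trans hx) le_rfl).abs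

lemma abs_dualP_le (g : L2 T) {x : ℝ} (h0 : 0 ≤ x) (hx : x ≤ T) :
    |dualP g x| ≤ T * (‖oneL2 T‖ * ‖g‖) := by
  rw [dualP, abs_neg, ← Real.norm_eq_abs]
  refine (intervalIntegral.norm_integral_le_of_norm_le_const (C := ‖oneL2 T‖ * ‖g‖)
    fun s hs => ?_).trans ?_
  · rw [uIoc_of_le h0] at hs
    exact abs_dualp_le g hs.1.le (hs.2.trans hx)
  · rw [sub_zero, abs_of_nonneg h0, mul_comm]
    gcongr

lemma abs_dualp_le_supNorm (g : L2 T) {x : ℝ} (hx : x ∈ Ioo 0 T) :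
    |dualp g x| ≤ supNorm T (dualp g) := by
  refine le_ciSup (f := fun y : Ioo (0 : ℝ) T => |dualp g y|) ?_ ⟨x, hx⟩
  refine ⟨‖oneL2 T‖ * ‖g‖, ?_⟩
  rintro _ ⟨y, rfl⟩
  exact abs_dualp_le g y.2.1.le y.2.2.le

lemma abs_dualP_le_supNorm (g : L2 T) {x : ℝ} (hx : x ∈ Ioo 0 T) :
    |dualP g x| ≤ supNorm T (dualP g) := by
  refine le_ciSup (f := fun y : Ioo (0 : ℝ) T => |dualP g y|) ?_ ⟨x, hx⟩
  refine ⟨T * (‖oneL2 T‖ * ‖g‖), ?_⟩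
  rintro _ ⟨y, rfl⟩
  exact abs_dualP_le g y.2.1.le y.2.2.le

lemma supNorm_nonneg (T : ℝ) (p : ℝ → ℝ) : 0 ≤ supNorm T p :=
  Real.iSup_nonneg fun _ => abs_nonneg _

lemma intervalIntegral_congr_ae_Ioo {u v : ℝ → ℝ} {x : ℝ}
    (h : u =ᵐ[volume.restrict (Ioo 0 T)] v) (h0 : 0 ≤ x) (hx : x ≤ T) :
    ∫ s in (0 : ℝ)..x, u s = ∫ s in (0 : ℝ)..x, v s := by
  rw [← setIntegral_Ioo_eq h0, ← setIntegral_Ioo_eq h0]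
  exact integral_congr_ae (ae_restrict_of_ae_restrict_of_subset (Ioo_subset_Ioo_right hx) h)

lemma dualp_sub (g v : L2 T) {x : ℝ} (h0 : 0 ≤ x) (hx : x ≤ T) :
    dualp (g - v) x = dualp g x - dualp v x := by
  rw [dualp, intervalIntegral_congr_ae_Ioo (Lp.coeFn_sub g v) h0 hx]
  exact intervalIntegral.integral_sub (L2.intervalIntegrable g le_rfl h0 hx)
    (L2.intervalIntegrable v le_rfl h0 hx)

lemma continuousOn_dualp (g : L2 T) : ContinuousOn (dualp g) (Icc 0 T) := by
  rcases le_or_gt 0 T with hT | hT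
  · have := intervalIntegral.continuousOn_primitive_interval (μ := volume) (f := g) (a := 0) (b := T)
      (by
        rw [uIcc_of_le hT, integrableOn_Icc_iff_integrableOn_Ioo]
        exact L2.integrable g)
    rwa [uIcc_of_le hT] at this
  · rw [Icc_eq_empty hT.not_ge]
    exact continuousOn_empty _

lemma intervalIntegrable_dualp (g : L2 T) {a b : ℝ} (ha : 0 ≤ a) (hab : a ≤ b) (hb : b ≤ T) :
    IntervalIntegrable (dualp g) volume a b :=
  ContinuousOn.intervalIntegrable_of_Icc hab
    ((continuousOn_dualp g).mono (Icc_subset_Icc ha hb))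

lemma dualP_sub (g v : L2 T) {x : ℝ} (h0 : 0 ≤ x) (hx : x ≤ T) :
    dualP (g - v) x = dualP g x - dualP v x := by
  have h1 : ∫ s in (0 : ℝ)..x, dualp (g - v) s = ∫ s in (0 : ℝ)..x, (dualp g s - dualp v s) := by
    refine intervalIntegral.integral_congr fun s hs => ?_
    rw [uIcc_of_le h0] at hs
    exact dualp_sub g v hs.1 (hs.2.trans hx)
  rw [dualP, h1, intervalIntegral.integral_sub (intervalIntegrable_dualp g le_rfl h0 hx)
    (intervalIntegrable_dualp v le_rfl h0 hx), dualP, dualP]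
  ring

/-- For v = ψ'' the dual variables are p = ψ' and P = -ψ, which are themselves admissible test
functions. -/
lemma dualp_of_ae_eq {v : L2 T} {ψ : ℝ → ℝ} (hψ : IsTest T ψ)
    (hv : v =ᵐ[volume.restrict (Ioo 0 T)] deriv (deriv ψ)) {x : ℝ} (h0 : 0 ≤ x) (hx : x ≤ T) :
    dualp v x = deriv ψ x := by
  rw [dualp, intervalIntegral_congr_ae_Ioo hv h0 hx, intervalIntegral.integral_deriv_eq_sub
    (fun y _ => hψ.deriv.differentiable y) (hψ.deriv.deriv.continuous.intervalIntegrable _ _),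
    hψ.deriv.eq_zero (x := 0) (by simp), sub_zero]

lemma dualP_of_ae_eq {v : L2 T} {ψ : ℝ → ℝ} (hψ : IsTest T ψ)
    (hv : v =ᵐ[volume.restrict (Ioo 0 T)] deriv (deriv ψ)) {x : ℝ} (h0 : 0 ≤ x) (hx : x ≤ T) :
    dualP v x = -ψ x := by
  have h1 : ∫ s in (0 : ℝ)..x, dualp v s = ∫ s in (0 : ℝ)..x, deriv ψ s := by
    refine intervalIntegral.integral_congr fun s hs => ?_
    rw [uIcc_of_le h0] at hs
    exact dualp_of_ae_eq hψ hv hs.1 (hs.2.trans hx)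
  rw [dualP, h1, intervalIntegral.integral_deriv_eq_sub
    (fun y _ => hψ.differentiable y) (hψ.deriv.continuous.intervalIntegrable _ _),
    hψ.eq_zero (x := 0) (by simp), sub_zero]

/-- The duality estimate for `TGV`, for a fixed splitting of the derivative. -/
lemma neg_inner_le_of_splitting (hT : 0 < T) {g : L2 T} (hg : ∀ l ∈ affineSet T, ⟪g, l⟫ = 0)
    (u : L2 T) {w : ℝ → ℝ} {a b : ℝ} (ha : 0 ≤ a) (hb : 0 ≤ b)
    (h1 : radonNorm T (distDeriv T u - distFun T w) ≤ ENNReal.ofReal a)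
    (h2 : tv T w ≤ ENNReal.ofReal b) :
    -⟪g, u⟫ ≤ supNorm T (dualp g) * a + supNorm T (dualP g) * b := by
  set K := ‖oneL2 T‖
  have hK : 0 ≤ K := norm_nonneg _
  refine le_of_forall_pos_le_add fun ε hε => ?_
  -- Replacing g by v costs Kδa in the p term, TKδb in the P term and δ‖u‖ in the inner product; D
  -- adds up these factors, and the 1 keeps it positive.
  set D := K * a + T * K * b + ‖u‖ + 1 with hD
  have hD0 : 0 < D := by positivity
  obtain ⟨v, ⟨ψ, hψ, hv⟩, hgv⟩ := Metric.mem_closure_iff.1 (mem_closure_testDeriv hT hg)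
    (ε / D) (by positivity)
  rw [dist_eq_norm] at hgv
  set δ := ‖g - v‖
  have hp : ∀ x, |deriv ψ x| ≤ supNorm T (dualp g) + K * δ := fun x => by
    by_cases hx : x ∈ Ioo 0 T
    · rw [← dualp_of_ae_eq hψ hv hx.1.le hx.2.le]
      have e1 := abs_dualp_le (g - v) hx.1.le hx.2.le
      have e2 := abs_dualp_le_supNorm g hx
      rw [dualp_sub g v hx.1.le hx.2.le] at e1
      have e3 := abs_sub_abs_le_abs_sub (dualp v x) (dualp g x)
      rw [abs_sub_comm] at e3
      linarith
    · rw [hψ.deriv.eq_zero hx, abs_zero]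
      have := supNorm_nonneg T (dualp g)
      positivity
  have hP : ∀ x, |-ψ x| ≤ supNorm T (dualP g) + T * (K * δ) := fun x => by
    by_cases hx : x ∈ Ioo 0 T
    · rw [← dualP_of_ae_eq hψ hv hx.1.le hx.2.le]
      have e1 := abs_dualP_le (g - v) hx.1.le hx.2.le
      have e2 := abs_dualP_le_supNorm g hx
      rw [dualP_sub g v hx.1.le hx.2.le] at e1
      have e3 := abs_sub_abs_le_abs_sub (dualP v x) (dualP g x)
      rw [abs_sub_comm] at e3
      linarith
    · rw [hψ.eq_zero hx, neg_zero, abs_zero]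
      have := supNorm_nonneg T (dualP g)
      positivity
  have b1 := apply_le_mul_of_radonNorm_le (distDeriv_sub_distFun_smul u w) ha h1 hψ.deriv hp
  have b2 := apply_le_mul_of_radonNorm_le (distDeriv_smul w) hb h2 hψ.neg hP
  -- The two contributions of w cancel, leaving only -∫uψ''.
  have e1 : (distDeriv T u - distFun T w) (deriv ψ) + distDeriv T w (fun x => -ψ x) = -⟪v, u⟫ := by
    have e3 : v = hψ.deriv.deriv.toL2 := Lp.ext (hv.trans hψ.deriv.deriv.coeFn_toL2.symm)
    rw [Pi.sub_apply, distDeriv_eq_inner u hψ.deriv, ← e3, real_inner_comm]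
    simp only [distDeriv, distFun, deriv.fun_neg, mul_neg, integral_neg]
    ring
  have e2 : -⟪g - v, u⟫ ≤ δ * ‖u‖ :=
    neg_le.1 (neg_le_of_abs_le (abs_real_inner_le_norm (g - v) u))
  rw [inner_sub_left] at e2
  have e4 : δ * D ≤ ε := by
    rw [lt_div_iff₀ hD0] at hgv
    exact hgv.le
  have e5 : 0 ≤ δ := norm_nonneg _
  rw [hD] at e4
  nlinarith

variable {α β : ℝ}

lemma exists_splitting_of_tgv_lt (hα : 0 < α) (hβ : 0 < β) {u : ℝ → ℝ} {c : ℝ}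
    (h : tgv T α β u < ENNReal.ofReal c) :
    ∃ w, IsBV T w ∧ ∃ a b, 0 ≤ a ∧ 0 ≤ b ∧
      radonNorm T (distDeriv T u - distFun T w) ≤ ENNReal.ofReal a ∧
      tv T w ≤ ENNReal.ofReal b ∧ α * a + β * b < c := by
  simp only [tgv, iInf_lt_iff] at h
  obtain ⟨w, hw, h⟩ := h
  set N := radonNorm T (distDeriv T u - distFun T w)
  have h1 := ENNReal.add_ne_top.1 (h.trans ENNReal.ofReal_lt_top).ne
  have hN : N ≠ ⊤ := by
    intro hN
    rw [hN, ENNReal.mul_top (by simpa using hα)] at h1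
    exact h1.1 rfl
  refine ⟨w, hw, N.toReal, (tv T w).toReal, ENNReal.toReal_nonneg, ENNReal.toReal_nonneg, ?_, ?_, ?_⟩
  · rw [ENNReal.ofReal_toReal hN]
  · rw [ENNReal.ofReal_toReal hw.2.ne]
  · rw [← ENNReal.ofReal_toReal hN, ← ENNReal.ofReal_toReal hw.2.ne, ← ENNReal.ofReal_mul hα.le,
      ← ENNReal.ofReal_mul hβ.le, ← ENNReal.ofReal_add (by positivity) (by positivity)] at h
    exact (ENNReal.ofReal_lt_ofReal_iff_of_nonneg (by positivity)).1 h

lemma tgv_le_of_splitting (hα : 0 < α) (hβ : 0 < β) {u w : ℝ → ℝ} {a b : ℝ} (ha : 0 ≤ a)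
    (hb : 0 ≤ b) (hw : IsBV T w)
    (h1 : radonNorm T (distDeriv T u - distFun T w) ≤ ENNReal.ofReal a)
    (h2 : tv T w ≤ ENNReal.ofReal b) : tgv T α β u ≤ ENNReal.ofReal (α * a + β * b) := by
  rw [ENNReal.ofReal_add (by positivity) (by positivity), ENNReal.ofReal_mul hα.le,
    ENNReal.ofReal_mul hβ.le]
  refine iInf_le_of_le w (iInf_le_of_le hw ?_)
  gcongr

lemma isBV_zero : IsBV T (fun _ => 0) := by
  refine ⟨integrableOn_zero, lt_of_le_of_lt (radonNorm_le (M := 0) fun φ _ _ => ?_)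
    ENNReal.ofReal_lt_top⟩
  simp [distDeriv]

lemma tgv_ne_top (hα : 0 < α) (hβ : 0 < β) {u : ℝ → ℝ} (hu : IsBV T u) : tgv T α β u ≠ ⊤ := by
  have h0 : tv T (fun _ => 0) ≤ ENNReal.ofReal 0 :=
    radonNorm_le fun φ _ _ => by simp [distDeriv]
  refine ne_top_of_le_ne_top ENNReal.ofReal_ne_top (tgv_le_of_splitting (w := fun _ => 0)
    (a := (tv T u).toReal) hα hβ ENNReal.toReal_nonneg le_rfl isBV_zero ?_ h0)
  rw [ENNReal.ofReal_toReal hu.2.ne]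
  have : distFun T (fun _ => 0) = 0 := by
    funext φ
    simp [distFun]
  rw [this, sub_zero, tv]

/-- The duality estimate for `TGV`. -/
lemma neg_inner_le_dualMax_mul_tgv (hT : 0 < T) (hα : 0 < α) (hβ : 0 < β) {g : L2 T}
    (hg : ∀ l ∈ affineSet T, ⟪g, l⟫ = 0) {u : L2 T} (hu : u ∈ bvSet T) :
    -⟪g, u⟫ ≤ dualMax α β g * (tgv T α β u).toReal := by
  have hM : 0 ≤ dualMax α β g :=
    le_max_of_le_left (div_nonneg (supNorm_nonneg _ _) hα.le)
  have key : ∀ c, (tgv T α β u).toReal < c → -⟪g, u⟫ ≤ dualMax α β g * c := by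
    intro c hc
    obtain ⟨w, -, a, b, ha, hb, h1, h2, h3⟩ := exists_splitting_of_tgv_lt (u := u) hα hβ
      ((ENNReal.lt_ofReal_iff_toReal_lt (tgv_ne_top hα hβ hu)).2 hc)
    refine (neg_inner_le_of_splitting hT hg u ha hb h1 h2).trans ?_
    have e1 : supNorm T (dualp g) ≤ dualMax α β g * α := (div_le_iff₀ hα).1 (le_max_left _ _)
    have e2 : supNorm T (dualP g) ≤ dualMax α β g * β := (div_le_iff₀ hβ).1 (le_max_right _ _)
    calc _ ≤ dualMax α β g * α * a + dualMax α β g * β * b := by gcongr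
      _ = dualMax α β g * (α * a + β * b) := by ring
      _ ≤ _ := by gcongr
  refine le_of_forall_pos_le_add fun ε hε => ?_
  have := key ((tgv T α β u).toReal + ε / (dualMax α β g + 1)) (by
    have : 0 < ε / (dualMax α β g + 1) := by positivity
    linarith)
  refine this.trans ?_
  rw [mul_add]
  gcongr
  rw [mul_div_assoc', div_le_iff₀ (by positivity)]
  nlinarith

end Dual

/-! ### Sublinearity of TGV, and its bounds on jumps, kinks and affine functions -/

section Atoms

variable {T α β : ℝ}

lemma distDeriv_smul_add {u v : ℝ → ℝ} (hu : IntegrableOn u (Ioo 0 T))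
    (hv : IntegrableOn v (Ioo 0 T)) (s : ℝ) {φ : ℝ → ℝ} (hφ : IsTest T φ) :
    distDeriv T (fun x => s * u x + v x) φ = s * distDeriv T u φ + distDeriv T v φ := by
  simp only [distDeriv, add_mul, mul_assoc]
  rw [integral_add ((hφ.deriv.integrable_mul hu).const_mul s) (hφ.deriv.integrable_mul hv),
    integral_const_mul]
  ring

lemma distFun_smul_add {u v : ℝ → ℝ} (hu : IntegrableOn u (Ioo 0 T))
    (hv : IntegrableOn v (Ioo 0 T)) (s : ℝ) {φ : ℝ → ℝ} (hφ : IsTest T φ) :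
    distFun T (fun x => s * u x + v x) φ = s * distFun T u φ + distFun T v φ := by
  simp only [distFun, add_mul, mul_assoc]
  rw [integral_add ((hφ.integrable_mul hu).const_mul s) (hφ.integrable_mul hv),
    integral_const_mul]

lemma tgv_smul_add_le (hα : 0 < α) (hβ : 0 < β) {u v : L2 T} {s c d : ℝ} (hs : 0 ≤ s)
    (hc : 0 ≤ c) (hd : 0 ≤ d) (hu : tgv T α β u ≤ ENNReal.ofReal c)
    (hv : tgv T α β v ≤ ENNReal.ofReal d) :
    tgv T α β (s • u + v : L2 T) ≤ ENNReal.ofReal (s * c + d) := by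
  refine ENNReal.le_of_forall_pos_le_add fun ε hε _ => ?_
  have hε' : (0 : ℝ) < ε := hε
  -- Near-optimal splittings of u and v are combined; with slack δ in each, the total slack is sδ +
  -- δ = ε.
  set δ : ℝ := ε / (s + 1)
  have hδ : 0 < δ := by positivity
  have hδs : s * δ + δ = ε := by
    have : δ * (s + 1) = ε := div_mul_cancel₀ _ (by positivity)
    linarith
  obtain ⟨w, hw, a, b, ha, hb, h1, h2, h3⟩ := exists_splitting_of_tgv_lt (c := c + δ) hα hβ
    (hu.trans_lt ((ENNReal.ofReal_lt_ofReal_iff_of_nonneg hc).2 (by linarith)))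
  obtain ⟨w', hw', a', b', ha', hb', h1', h2', h3'⟩ := exists_splitting_of_tgv_lt (c := d + δ)
    hα hβ (hv.trans_lt ((ENNReal.ofReal_lt_ofReal_iff_of_nonneg hd).2 (by linarith)))
  have hcoe : (s • u + v : L2 T) =ᵐ[volume.restrict (Ioo 0 T)] fun x => s * u x + v x := by
    filter_upwards [Lp.coeFn_add (s • u) v, Lp.coeFn_smul s u] with x e1 e2
    rw [e1, Pi.add_apply, e2, Pi.smul_apply, smul_eq_mul]
  have htv : tv T (fun x => s * w x + w' x) ≤ ENNReal.ofReal (s * b + b') :=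
    radonNorm_le fun φ hφ hφ1 => by
      rw [distDeriv_smul_add hw.1 hw'.1 s hφ]
      have e1 := apply_le_of_radonNorm_le hb h2 hφ hφ1
      have e2 := apply_le_of_radonNorm_le hb' h2' hφ hφ1
      gcongr
  have := tgv_le_of_splitting (u := (s • u + v : L2 T)) (w := fun x => s * w x + w' x)
    (a := s * a + a') (b := s * b + b') hα hβ (by positivity) (by positivity)
    ⟨(hw.1.const_mul s).add hw'.1, htv.trans_lt ENNReal.ofReal_lt_top⟩
    (radonNorm_le fun φ hφ hφ1 => by
      rw [Pi.sub_apply, distDeriv_congr hcoe,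
        distDeriv_smul_add (L2.integrable u) (L2.integrable v) s hφ,
        distFun_smul_add hw.1 hw'.1 s hφ]
      have e1 := apply_le_of_radonNorm_le ha h1 hφ hφ1
      have e2 := apply_le_of_radonNorm_le ha' h1' hφ hφ1
      rw [Pi.sub_apply] at e1 e2
      nlinarith) htv
  refine this.trans ?_
  rw [← ENNReal.ofReal_coe_nnreal, ← ENNReal.ofReal_add (by positivity) hε'.le]
  refine ENNReal.ofReal_le_ofReal ?_
  nlinarith

/-- Du = (Du - w) + w, and as a measure w has norm at most its L¹ norm. -/
lemma mem_bvSet_of_tgv_le (hα : 0 < α) (hβ : 0 < β) {u : L2 T} {c : ℝ} (hc : 0 ≤ c)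
    (hu : tgv T α β u ≤ ENNReal.ofReal c) : u ∈ bvSet T := by
  obtain ⟨w, hw, a, b, ha, hb, h1, h2, h3⟩ := exists_splitting_of_tgv_lt (c := c + 1) hα hβ
    (hu.trans_lt ((ENNReal.ofReal_lt_ofReal_iff_of_nonneg hc).2 (by linarith)))
  refine ⟨L2.integrable u, lt_of_le_of_lt (radonNorm_le (M := a + ∫ x in Ioo 0 T, |w x|)
    fun φ hφ hφ1 => ?_) ENNReal.ofReal_lt_top⟩
  have e1 := apply_le_of_radonNorm_le ha h1 hφ hφ1
  have e2 : distFun T w φ ≤ ∫ x in Ioo 0 T, |w x| := by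
    refine integral_mono (hφ.integrable_mul hw.1) hw.1.abs fun x => ?_
    refine (le_abs_self _).trans ?_
    rw [abs_mul]
    exact mul_le_of_le_one_right (abs_nonneg _) (hφ1 x)
  rw [Pi.sub_apply] at e1
  linarith

lemma setIntegral_indicator_mul {a b : ℝ} (h0 : 0 ≤ a) (hab : a ≤ b) (hb : b ≤ T)
    (f h : ℝ → ℝ) :
    ∫ x in Ioo 0 T, (Ioo a b).indicator f x * h x = ∫ x in a..b, f x * h x := by
  have : (fun x => (Ioo a b).indicator f x * h x) = (Ioo a b).indicator fun x => f x * h x := by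
    funext x
    by_cases hx : x ∈ Ioo a b <;> simp [hx]
  rw [this, setIntegral_indicator measurableSet_Ioo,
    inter_eq_right.2 (Ioo_subset_Ioo h0 hb), setIntegral_Ioo_eq hab]

lemma integrable_mul_indicator (c a b : ℝ) :
    IntegrableOn (fun x => c * (Ioo a b).indicator (fun _ => (1 : ℝ)) x) (Ioo 0 T) := by
  refine Integrable.const_mul ?_ c
  exact (integrable_const (1 : ℝ)).indicator measurableSet_Ioo

lemma distDeriv_mul_indicator (c : ℝ) {a b : ℝ} (h0 : 0 ≤ a) (hab : a ≤ b) (hb : b ≤ T)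
    {φ : ℝ → ℝ} (hφ : IsTest T φ) :
    distDeriv T (fun x => c * (Ioo a b).indicator (fun _ => (1 : ℝ)) x) φ = c * (φ a - φ b) := by
  simp only [distDeriv, mul_assoc]
  rw [integral_const_mul, setIntegral_indicator_mul h0 hab hb]
  simp only [one_mul]
  rw [intervalIntegral.integral_deriv_eq_sub (fun y _ => hφ.differentiable y)
    (hφ.deriv.continuous.intervalIntegrable _ _)]
  ring

lemma mul_le_abs_of_abs_le_one {c y : ℝ} (h : |y| ≤ 1) : c * y ≤ |c| :=
  (le_abs_self _).trans ((abs_mul _ _).trans_le (mul_le_of_le_one_right (abs_nonneg _) h))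

lemma tv_mul_indicator_right_le (c : ℝ) {x : ℝ} (hx : x ∈ Ioo 0 T) :
    tv T (fun t => c * (Ioo x T).indicator (fun _ => (1 : ℝ)) t) ≤ ENNReal.ofReal |c| :=
  radonNorm_le fun φ hφ h1 => by
    rw [distDeriv_mul_indicator c hx.1.le hx.2.le le_rfl hφ, hφ.eq_zero (x := T) (by simp),
      sub_zero]
    exact mul_le_abs_of_abs_le_one (h1 x)

lemma tv_mul_indicator_left_le (c : ℝ) {x : ℝ} (hx : x ∈ Ioo 0 T) :
    tv T (fun t => c * (Ioo 0 x).indicator (fun _ => (1 : ℝ)) t) ≤ ENNReal.ofReal |c| :=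
  radonNorm_le fun φ hφ h1 => by
    rw [distDeriv_mul_indicator c le_rfl hx.1.le hx.2.le hφ, hφ.eq_zero (x := 0) (by simp),
      zero_sub]
    exact mul_le_abs_of_abs_le_one (by rw [abs_neg]; exact h1 x)

lemma coeFn_smul_jump (c x : ℝ) :
    (c • jump T x : L2 T) =ᵐ[volume.restrict (Ioo 0 T)] fun t => c * jumpFun T x t := by
  filter_upwards [Lp.coeFn_smul c (jump T x), (memLp_jumpFun T x).coeFn_toLp] with t h1 h2
  rw [h1, Pi.smul_apply, smul_eq_mul, jump, h2]

lemma coeFn_smul_kink (c x : ℝ) :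
    (c • kink T x : L2 T) =ᵐ[volume.restrict (Ioo 0 T)] fun t => c * kinkFun T x t := by
  filter_upwards [Lp.coeFn_smul c (kink T x), (memLp_kinkFun T x).coeFn_toLp] with t h1 h2
  rw [h1, Pi.smul_apply, smul_eq_mul, kink, h2]

/-- Take w = 0: the only cost is the jump. An inequality for |c| also covers a coefficient with
`Real.sign` equal to 0. -/
lemma tgv_smul_jump_le (hα : 0 < α) (hβ : 0 < β) {c x : ℝ} (hc : |c| ≤ 1 / α)
    (hx : x ∈ Ioo 0 T) : tgv T α β (c • jump T x : L2 T) ≤ ENNReal.ofReal 1 := by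
  rw [tgv_congr (coeFn_smul_jump c x)]
  refine (tgv_le_of_splitting (a := |c|) (b := 0) hα hβ (abs_nonneg _) le_rfl isBV_zero ?_
    (radonNorm_le fun φ _ _ => by simp [distDeriv])).trans (ENNReal.ofReal_le_ofReal ?_)
  · have : distFun T (fun _ => 0) = 0 := by
      funext φ
      simp [distFun]
    rw [this, sub_zero]
    exact tv_mul_indicator_right_le c hx
  · rw [le_div_iff₀ hα] at hc
    linarith

lemma integral_affine_mul_deriv (a b c x : ℝ) {φ : ℝ → ℝ} (hφ : IsTest T φ) :
    ∫ t in a..b, c * (t - x) * deriv φ t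
      = c * (b - x) * φ b - c * (a - x) * φ a - ∫ t in a..b, c * φ t := by
  exact intervalIntegral.integral_mul_deriv_eq_deriv_mul
    (fun t _ => by simpa using ((hasDerivAt_id t).sub_const x).const_mul c)
    (fun t _ => (hφ.differentiable t).hasDerivAt) (continuous_const.intervalIntegrable _ _)
    (hφ.deriv.continuous.intervalIntegrable _ _)

/-- Take w to be the derivative of the kink, a multiple of a step function: Du - w vanishes and Dw
is a point mass at x. This works for every node in (0,T), not only for those allowed in `extB`. -/
lemma tgv_smul_kink_le (hα : 0 < α) (hβ : 0 < β) {c x : ℝ} (hc : |c| ≤ 1 / β)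
    (hx : x ∈ Ioo 0 T) : tgv T α β (c • kink T x : L2 T) ≤ ENNReal.ofReal 1 := by
  rw [tgv_congr (coeFn_smul_kink c x)]
  have hc' : α * 0 + β * |c| ≤ 1 := by
    rw [le_div_iff₀ hβ] at hc
    linarith
  by_cases hxT : x < T / 2
  · have htv := tv_mul_indicator_left_le (-c) hx
    refine (tgv_le_of_splitting (a := 0) (b := |c|) hα hβ le_rfl (abs_nonneg _)
      ⟨integrable_mul_indicator (-c) 0 x, htv.trans_lt ENNReal.ofReal_lt_top⟩
      (radonNorm_le fun φ hφ _ => le_of_eq ?_)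
      (htv.trans_eq (by rw [abs_neg]))).trans (ENNReal.ofReal_le_ofReal hc')
    simp only [Pi.sub_apply, distDeriv, distFun, kinkFun, if_pos hxT, mul_assoc]
    rw [integral_const_mul, integral_const_mul, setIntegral_indicator_mul le_rfl hx.1.le hx.2.le,
      setIntegral_indicator_mul le_rfl hx.1.le hx.2.le]
    have := integral_affine_mul_deriv 0 x (-1) x hφ
    simp only [neg_mul, one_mul, neg_sub, sub_self, zero_mul, hφ.eq_zero (x := 0) (by simp),
      mul_zero, intervalIntegral.integral_neg] at this
    simp only [one_mul]
    rw [this]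
    ring
  · have htv := tv_mul_indicator_right_le c hx
    refine (tgv_le_of_splitting (a := 0) (b := |c|) hα hβ le_rfl (abs_nonneg _)
      ⟨integrable_mul_indicator c x T, htv.trans_lt ENNReal.ofReal_lt_top⟩
      (radonNorm_le fun φ hφ _ => le_of_eq ?_) htv).trans (ENNReal.ofReal_le_ofReal hc')
    simp only [Pi.sub_apply, distDeriv, distFun, kinkFun, if_neg hxT, mul_assoc]
    rw [integral_const_mul, integral_const_mul, setIntegral_indicator_mul hx.1.le hx.2.le le_rfl,
      setIntegral_indicator_mul hx.1.le hx.2.le le_rfl]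
    have := integral_affine_mul_deriv x T 1 x hφ
    simp only [one_mul, sub_self, zero_mul, hφ.eq_zero (x := T) (by simp), mul_zero] at this
    simp only [one_mul]
    rw [this]
    ring

lemma tgv_le_of_mem_extB (hα : 0 < α) (hβ : 0 < β) {v : L2 T} (hv : v ∈ extB T α β) :
    tgv T α β v ≤ ENNReal.ofReal 1 := by
  have h : ∀ {γ : ℝ}, 0 < γ → |1 / γ| ≤ 1 / γ ∧ |-(1 / γ)| ≤ 1 / γ := fun hγ => by
    rw [abs_neg, abs_of_pos (one_div_pos.2 hγ)]
    exact ⟨le_rfl, le_rfl⟩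
  rcases hv with ⟨x, hx, rfl | rfl⟩ | ⟨x, hx, rfl | rfl⟩
  · exact tgv_smul_jump_le hα hβ (h hα).1 hx
  · rw [← neg_smul]
    exact tgv_smul_jump_le hα hβ (h hα).2 hx
  all_goals
    have hx' : x ∈ Ioo 0 T := by
      have : 0 < β / α := by positivity
      exact ⟨this.trans hx.1, by linarith [hx.2]⟩
  · exact tgv_smul_kink_le hα hβ (h hβ).1 hx'
  · rw [← neg_smul]
    exact tgv_smul_kink_le hα hβ (h hβ).2 hx'

lemma abs_sign_div_le {γ : ℝ} (hγ : 0 < γ) (y : ℝ) : |Real.sign y / γ| ≤ 1 / γ := by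
  rw [abs_div, abs_of_pos hγ]
  gcongr
  rcases Real.sign_apply_eq y with h | h | h <;> simp [h]

lemma tgv_candidate_le (hα : 0 < α) (hβ : 0 < β) (g : L2 T) {xS xK : ℝ} (hS : xS ∈ Ioo 0 T)
    (hK : xK ∈ Ioo 0 T) : tgv T α β (candidate α β g xS xK) ≤ ENNReal.ofReal 1 := by
  unfold candidate
  split_ifs
  · exact tgv_smul_jump_le hα hβ (abs_sign_div_le hα _) hS
  · exact tgv_smul_kink_le hα hβ (abs_sign_div_le hβ _) hK

/-- Take w to be the constant slope: both terms vanish. -/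
lemma tgv_affine_le (hT : 0 < T) (hα : 0 < α) (hβ : 0 < β) {l : L2 T} (hl : l ∈ affineSet T) :
    tgv T α β l ≤ ENNReal.ofReal 0 := by
  obtain ⟨c, d, h⟩ := hl
  rw [tgv_congr h]
  have htv : tv T (fun _ => c) ≤ ENNReal.ofReal 0 := radonNorm_le fun φ hφ _ => by
    rw [distDeriv, integral_deriv_mul_eq_neg hT hφ contDiff_const]
    simp
  refine (tgv_le_of_splitting (a := 0) (b := 0) hα hβ le_rfl le_rfl
    ⟨integrable_const c, htv.trans_lt ENNReal.ofReal_lt_top⟩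
    (radonNorm_le fun φ hφ _ => le_of_eq ?_) htv).trans (by simp)
  have hcd : ContDiff ℝ ∞ fun x : ℝ => c * x + d := (contDiff_const.mul contDiff_id).add
    contDiff_const
  have hd : deriv (fun x : ℝ => c * x + d) = fun _ => c := by
    funext x
    simp
  rw [Pi.sub_apply, distDeriv, distFun, integral_deriv_mul_eq_neg hT hφ hcd, hd]
  ring

lemma tgv_combine_le (hT : 0 < T) (hα : 0 < α) (hβ : 0 < β) {A : Finset (L2 T)}
    {lam : L2 T → ℝ} {l : L2 T} (hA : ∀ v ∈ A, tgv T α β v ≤ ENNReal.ofReal 1)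
    (hlam : ∀ v ∈ A, 0 ≤ lam v) (hl : l ∈ affineSet T) :
    tgv T α β (combine A lam l) ≤ ENNReal.ofReal (∑ v ∈ A, lam v) := by
  classical
  unfold combine
  induction A using Finset.induction_on with
  | empty => simpa using tgv_affine_le hT hα hβ hl
  | insert v A hv ih =>
    rw [Finset.sum_insert hv, Finset.sum_insert hv, add_assoc]
    have h0 : 0 ≤ lam v := hlam v (Finset.mem_insert_self v A)
    have hA' : ∀ v ∈ A, 0 ≤ lam v := fun v hv => hlam v (Finset.mem_insert_of_mem hv)
    simpa using tgv_smul_add_le hα hβ h0 zero_le_one (Finset.sum_nonneg hA')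
      (hA v (Finset.mem_insert_self v A)) (ih (fun v hv => hA v (Finset.mem_insert_of_mem hv)) hA')

end Atoms

/-! ### Gradient inequalities and weak limits in a Hilbert space -/

section Hilbert

variable {H : Type*} [NormedAddCommGroup H] [InnerProductSpace ℝ H] [CompleteSpace H]

lemma hasDerivAt_comp_line {f : H → ℝ} (hf : Differentiable ℝ f) (x d : H) (t : ℝ) :
    HasDerivAt (fun s : ℝ => f (x + s • d)) ⟪gradient f (x + t • d), d⟫ t := by
  have h1 := ((hf (x + t • d)).hasGradientAt).hasFDerivAt
  have h2 : HasDerivAt (fun s : ℝ => x + s • d) d t := by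
    simpa using ((hasDerivAt_id t).smul_const d).const_add x
  exact h1.comp_hasDerivAt t h2

lemma add_inner_gradient_le {f : H → ℝ} (hf : Differentiable ℝ f) (hc : ConvexOn ℝ univ f)
    (x y : H) : f x + ⟪gradient f x, y - x⟫ ≤ f y := by
  have h1 : ConvexOn ℝ univ fun t : ℝ => f (x + t • (y - x)) := by
    have := hc.comp_affineMap (AffineMap.lineMap x y : ℝ →ᵃ[ℝ] H)
    rw [preimage_univ] at this
    refine this.congr fun t _ => ?_
    simp [AffineMap.lineMap_apply, add_comm]
  have h2 := h1.le_slope_of_hasDerivAt (mem_univ 0) (mem_univ 1) one_pos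
    (hasDerivAt_comp_line hf x (y - x) 0)
  simp only [slope_def_field, zero_smul, add_zero, one_smul, sub_zero, div_one,
    add_sub_cancel] at h2
  linarith

lemma le_add_inner_gradient_add_sq {f : H → ℝ} (hf : Differentiable ℝ f) {L : ℝ}
    (hL : ∀ v w : H, ‖gradient f v - gradient f w‖ ≤ L * ‖v - w‖) (x d : H) :
    f (x + d) ≤ f x + ⟪gradient f x, d⟫ + L / 2 * ‖d‖ ^ 2 := by
  -- The Lipschitz bound makes the derivative of this remainder nonpositive on (0,1), so comparing t
  -- = 0 with t = 1 replaces an integral remainder.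
  let φ : ℝ → ℝ := fun t =>
    f (x + t • d) - t * ⟪gradient f x, d⟫ - L / 2 * ‖d‖ ^ 2 * t ^ 2
  have hφ : ∀ t, HasDerivAt φ (⟪gradient f (x + t • d), d⟫ - ⟪gradient f x, d⟫
      - L / 2 * ‖d‖ ^ 2 * (2 * t)) t := fun t => by
    have h1 : HasDerivAt (fun t : ℝ => t * ⟪gradient f x, d⟫) ⟪gradient f x, d⟫ t := by
      simpa using (hasDerivAt_id t).mul_const ⟪gradient f x, d⟫
    have h2 : HasDerivAt (fun t : ℝ => L / 2 * ‖d‖ ^ 2 * t ^ 2) (L / 2 * ‖d‖ ^ 2 * (2 * t)) t := by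
      simpa using (hasDerivAt_pow 2 t).const_mul (L / 2 * ‖d‖ ^ 2)
    exact ((hasDerivAt_comp_line hf x d t).sub h1).sub h2
  have hanti : AntitoneOn φ (Icc 0 1) := by
    refine antitoneOn_of_deriv_nonpos (convex_Icc 0 1)
      (fun t _ => (hφ t).continuousAt.continuousWithinAt)
      (fun t _ => (hφ t).differentiableAt.differentiableWithinAt) fun t ht => ?_
    rw [interior_Icc] at ht
    rw [(hφ t).deriv, ← inner_sub_left]
    have h1 := (real_inner_le_norm (gradient f (x + t • d) - gradient f x) d).trans
      (mul_le_mul_of_nonneg_right (hL (x + t • d) x) (norm_nonneg d))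
    rw [add_sub_cancel_left, norm_smul, Real.norm_eq_abs, abs_of_pos ht.1] at h1
    nlinarith
  have := hanti (left_mem_Icc.2 zero_le_one) (right_mem_Icc.2 zero_le_one) zero_le_one
  simp only [φ, one_smul, zero_smul, add_zero] at this
  linarith

/-- Bounded sequences of a Hilbert space converge weakly along ultrafilters. -/
lemma exists_weak_limit (𝒰 : Ultrafilter ℕ) {x : ℕ → H} {R : ℝ} (hx : ∀ n, ‖x n‖ ≤ R) :
    ∃ z : H, ∀ y : H, Tendsto (fun n => ⟪x n, y⟫) 𝒰 (𝓝 ⟪z, y⟫) := by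
  let X : ℕ → WeakDual ℝ H := fun n =>
    StrongDual.toWeakDual (InnerProductSpace.toDual ℝ H (x n))
  obtain ⟨Z, -, hZ⟩ := (WeakDual.isCompact_closedBall (𝕜 := ℝ) (E := H) 0 R).ultrafilter_le_nhds
    (𝒰.map X) (by
      rw [le_principal_iff]
      refine Filter.mem_map.2 (Filter.univ_mem' fun n => ?_)
      simpa [X] using hx n)
  refine ⟨(InnerProductSpace.toDual ℝ H).symm (WeakDual.toStrongDual Z), fun y => ?_⟩
  have h1 : Tendsto (fun n => X n y) 𝒰 (𝓝 (Z y)) :=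
    ((WeakDual.eval_continuous y).tendsto Z).comp hZ
  rw [InnerProductSpace.toDual_symm_apply]
  exact h1

end Hilbert

/-! ### Existence of a minimizer of J -/

section Existence

variable {T α β : ℝ}

lemma radonNorm_distFun_le_lintegral {w : ℝ → ℝ} (hw : IntegrableOn w (Ioo 0 T)) :
    radonNorm T (distFun T w) ≤ ∫⁻ x in Ioo 0 T, ‖w x‖ₑ := by
  rw [← ofReal_integral_norm_eq_lintegral_enorm hw]
  refine radonNorm_le fun φ hφ hφ1 => ?_
  refine integral_mono (hφ.integrable_mul hw) hw.norm fun x => ?_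
  refine (le_abs_self _).trans ?_
  rw [abs_mul]
  exact mul_le_of_le_one_right (abs_nonneg _) (hφ1 x)

lemma exists_norm_le_of_bvNorm_le (hT : 0 < T) : ∃ C, 0 ≤ C ∧ ∀ (u : L2 T) (R : ℝ), 0 ≤ R →
    bvNorm T u ≤ ENNReal.ofReal R → ‖u‖ ≤ C * R := by
  obtain ⟨C, hC, h⟩ := exists_embedding_const hT
  refine ⟨C, hC, fun u R hR hu => ?_⟩
  obtain ⟨W, hW, hn⟩ := h u (L2.integrable u) R hR
    ((radonNorm_distFun_le_lintegral (L2.integrable u)).trans (le_self_add.trans hu))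
    (le_add_self.trans hu)
  rwa [← Lp.ext hW]

/-- Both Radon norms are suprema, over independent φ and ψ, so the bound on their weighted sum may
be checked pair by pair. For a fixed pair the left side is weakly continuous in (u, w), which is why
this form survives weak limits. The supremum is taken over φ first, with ψ fixed. -/
lemma tgv_le_of_forall_isTest (hα : 0 < α) (hβ : 0 < β) {u w : L2 T} {c : ℝ}
    (h : ∀ φ ψ, IsTest T φ → IsTest T ψ → (∀ x, |φ x| ≤ 1) → (∀ x, |ψ x| ≤ 1) →
      α * (distDeriv T u - distFun T w) φ + β * distDeriv T w ψ ≤ c) :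
    0 ≤ c ∧ tgv T α β u ≤ ENNReal.ofReal c := by
  have z1 : ∀ x : ℝ, |(fun _ => 0 : ℝ → ℝ) x| ≤ 1 := fun x => by simp
  have z2 : (distDeriv T u - distFun T w) (fun _ => 0) = 0 := by simp [distDeriv, distFun]
  have z3 : distDeriv T w (fun _ => 0) = 0 := by simp [distDeriv]
  have hc : 0 ≤ c := by simpa [z2, z3] using h _ _ IsTest.zero IsTest.zero z1 z1
  refine ⟨hc, ?_⟩
  set N := radonNorm T (distDeriv T u - distFun T w) with hN
  have h1 : ∀ ψ, IsTest T ψ → (∀ x, |ψ x| ≤ 1) →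
      N ≤ ENNReal.ofReal ((c - β * distDeriv T w ψ) / α) := fun ψ hψ hψ1 =>
    radonNorm_le fun φ hφ hφ1 => by
      rw [le_div_iff₀ hα]
      linarith [h φ ψ hφ hψ hφ1 hψ1]
  have h1' : ∀ ψ, IsTest T ψ → (∀ x, |ψ x| ≤ 1) →
      N.toReal ≤ (c - β * distDeriv T w ψ) / α := fun ψ hψ hψ1 =>
    ENNReal.toReal_le_of_le_ofReal (div_nonneg (by
      have := h _ ψ IsTest.zero hψ z1 hψ1
      rw [z2] at this
      linarith) hα.le) (h1 ψ hψ hψ1)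
  have hNtop : N ≠ ⊤ := ne_top_of_le_ne_top ENNReal.ofReal_ne_top (h1 _ IsTest.zero z1)
  have h2 : tv T w ≤ ENNReal.ofReal ((c - α * N.toReal) / β) := radonNorm_le fun ψ hψ hψ1 => by
    have := h1' ψ hψ hψ1
    rw [le_div_iff₀ hα] at this
    rw [le_div_iff₀ hβ]
    linarith
  have h3 : 0 ≤ (c - α * N.toReal) / β := by
    have := h1' _ IsTest.zero z1
    rw [z3, le_div_iff₀ hα] at this
    exact div_nonneg (by linarith) hβ.le
  refine (tgv_le_of_splitting hα hβ ENNReal.toReal_nonneg h3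
    ⟨L2.integrable w, h2.trans_lt ENNReal.ofReal_lt_top⟩ (ENNReal.ofReal_toReal hNtop).ge
    h2).trans_eq ?_
  congr 1
  field_simp
  ring

lemma zero_mem_bvSet : (0 : L2 T) ∈ bvSet T :=
  (isBV_congr (Lp.coeFn_zero ℝ 2 _)).2 isBV_zero

lemma exists_minimizer (hT : 0 < T) (hα : 0 < α) (hβ : 0 < β) {f : L2 T → ℝ}
    (hf : Differentiable ℝ f) (hconv : ConvexOn ℝ univ f) {Cf : ℝ} (hbdd : ∀ v, -Cf ≤ f v)
    (hcoer : ∀ c : ℝ, ∃ R : ℝ, ∀ v ∈ bvSet T, J T α β f v ≤ c → bvNorm T v ≤ ENNReal.ofReal R) :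
    IsLeast (J T α β f '' bvSet T) (minJ T α β f) := by
  set m := minJ T α β f with hm
  have hB : BddBelow (J T α β f '' bvSet T) := by
    refine ⟨-Cf, ?_⟩
    rintro _ ⟨u, -, rfl⟩
    have : 0 ≤ (tgv T α β u).toReal := ENNReal.toReal_nonneg
    unfold J
    linarith [hbdd u]
  have hne : (J T α β f '' bvSet T).Nonempty := ⟨_, 0, zero_mem_bvSet, rfl⟩
  refine ⟨?_, fun y hy => csInf_le hB hy⟩
  have hseq : ∀ n : ℕ, ∃ u ∈ bvSet T, J T α β f u ≤ m + 1 ∧ ∃ w, IsBV T w ∧ ∃ a b : ℝ,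
      0 ≤ a ∧ 0 ≤ b ∧ radonNorm T (distDeriv T u - distFun T w) ≤ ENNReal.ofReal a ∧
      tv T w ≤ ENNReal.ofReal b ∧ f u + (α * a + β * b) ≤ m + 1 / ((n : ℝ) + 1) ∧
      f u + (α * a + β * b) ≤ m + 1 := by
    intro n
    have hpos : 0 < 1 / ((n : ℝ) + 1) := by positivity
    have hle : 1 / ((n : ℝ) + 1) ≤ 1 := by
      rw [div_le_one (by positivity)]
      linarith [n.cast_nonneg (α := ℝ)]
    obtain ⟨_, ⟨u, hu, rfl⟩, hlt⟩ := exists_lt_of_csInf_lt hne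
      (show sInf (J T α β f '' bvSet T) < m + 1 / ((n : ℝ) + 1) by
        rw [hm, minJ]; linarith)
    refine ⟨u, hu, by linarith, ?_⟩
    unfold J at hlt
    obtain ⟨w, hw, a, b, ha, hb, h1, h2, h3⟩ := exists_splitting_of_tgv_lt (u := u)
      (c := m + 1 / ((n : ℝ) + 1) - f u) hα hβ
      ((ENNReal.lt_ofReal_iff_toReal_lt (tgv_ne_top hα hβ hu)).2 (by linarith))
    exact ⟨w, hw, a, b, ha, hb, h1, h2, by linarith, by linarith⟩
  choose u hu hJu w hw a b ha hb h1 h2 h3 h4 using hseq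
  obtain ⟨R₀, hR₀⟩ := hcoer (m + 1)
  set R := max R₀ 0
  have hR : 0 ≤ R := le_max_right _ _
  have hbv : ∀ n, bvNorm T (u n) ≤ ENNReal.ofReal R := fun n =>
    (hR₀ _ (hu n) (hJu n)).trans (ENNReal.ofReal_le_ofReal (le_max_left _ _))
  obtain ⟨C₁, hC₁, hC₁u⟩ := exists_norm_le_of_bvNorm_le hT
  obtain ⟨C₂, hC₂, hC₂w⟩ := exists_embedding_const hT
  have hS : 0 ≤ m + 1 + Cf := by
    have := mul_nonneg hα.le (ha 0)
    have := mul_nonneg hβ.le (hb 0)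
    linarith [hbdd (u 0), h4 0]
  have ha' : ∀ n, a n ≤ (m + 1 + Cf) / α := fun n => by
    rw [le_div_iff₀ hα]
    have := mul_nonneg hβ.le (hb n)
    linarith [hbdd (u n), h4 n]
  have hb' : ∀ n, b n ≤ (m + 1 + Cf) / β := fun n => by
    rw [le_div_iff₀ hβ]
    have := mul_nonneg hα.le (ha n)
    linarith [hbdd (u n), h4 n]
  -- As a distribution w = Du - (Du - w) has norm at most R + (m+1+Cf)/α, and its total variation is
  -- at most (m+1+Cf)/β, so M serves for both.
  set M := R + (m + 1 + Cf) / α + (m + 1 + Cf) / β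
  have hA0 : 0 ≤ (m + 1 + Cf) / α := by positivity
  have hB0 : 0 ≤ (m + 1 + Cf) / β := by positivity
  have hM : 0 ≤ M := by positivity
  have hW : ∀ n, ∃ W : L2 T, W =ᵐ[volume.restrict (Ioo 0 T)] w n ∧ ‖W‖ ≤ C₂ * M := by
    intro n
    refine hC₂w (w n) (hw n).1 M hM (radonNorm_le fun φ hφ hφ1 => ?_)
      ((h2 n).trans (ENNReal.ofReal_le_ofReal ?_))
    · have e1 := apply_le_of_radonNorm_le hR (le_add_self.trans (hbv n)) hφ hφ1
      have e2 := apply_le_mul_of_radonNorm_le (distDeriv_sub_distFun_smul (u n) (w n)) (ha n)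
        (h1 n) hφ.neg (c := 1) fun x => by rw [abs_neg]; exact hφ1 x
      have e3 := distDeriv_sub_distFun_smul (T := T) (u n) (w n) (-1) φ
      simp only [neg_one_mul] at e3
      rw [e3, Pi.sub_apply] at e2
      linarith [ha' n]
    · linarith [hb' n]
  choose W hWw hWn using hW
  -- One ultrafilter gives weak limits of u and W simultaneously, without choosing subsequences.
  let 𝒰 : Ultrafilter ℕ := hyperfilter ℕ
  obtain ⟨z, hz⟩ := exists_weak_limit 𝒰 fun n => hC₁u (u n) R hR (hbv n)
  obtain ⟨y, hy⟩ := exists_weak_limit 𝒰 hWn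
  have htend : Tendsto (fun n : ℕ => m + 1 / ((n : ℝ) + 1)) 𝒰 (𝓝 (m + 0)) :=
    (tendsto_one_div_add_atTop_nhds_zero_nat.const_add m).mono_left Nat.hyperfilter_le_atTop
  rw [add_zero] at htend
  obtain ⟨hc, hz'⟩ := tgv_le_of_forall_isTest (u := z) (w := y) (c := m - f z) hα hβ (by
    intro φ ψ hφ hψ hφ1 hψ1
    -- By convexity the linearization of f at z lies below f(u n). It is affine in u n, so it passes
    -- to the weak limit and stands in for weak lower semicontinuity of f.
    have hlim : Tendsto (fun n => f z + ⟪gradient f z, u n - z⟫ +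
        (α * (distDeriv T (u n) - distFun T (W n)) φ + β * distDeriv T (W n) ψ)) 𝒰
        (𝓝 (f z + ⟪gradient f z, z - z⟫ +
          (α * (distDeriv T z - distFun T y) φ + β * distDeriv T y ψ))) := by
      simp only [Pi.sub_apply, distDeriv_eq_inner _ hφ, distDeriv_eq_inner _ hψ,
        distFun_eq_inner _ hφ, real_inner_comm _ (gradient f z), inner_sub_left]
      exact (((hz _).sub tendsto_const_nhds).const_add _).add
        ((((hz _).neg.sub (hy _)).const_mul α).add ((hy _).neg.const_mul β))
    have := le_of_tendsto_of_tendsto' hlim htend fun n => by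
      have e1 := add_inner_gradient_le hf hconv z (u n)
      have e2 := apply_le_of_radonNorm_le (ha n) (h1 n) hφ hφ1
      have e3 := apply_le_of_radonNorm_le (hb n) (h2 n) hψ hψ1
      rw [distFun_congr (hWw n), distDeriv_congr (hWw n)]
      have e4 := mul_le_mul_of_nonneg_left e2 hα.le
      have e5 := mul_le_mul_of_nonneg_left e3 hβ.le
      linarith [h3 n]
    rw [sub_self, inner_zero_right] at this
    linarith)
  have hzBV := mem_bvSet_of_tgv_le hα hβ hc hz'
  refine ⟨z, hzBV, le_antisymm ?_ (csInf_le hB ⟨z, hzBV, rfl⟩)⟩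
  have := ENNReal.toReal_le_of_le_ofReal hc hz'
  unfold J
  linarith

end Existence

/-! ### Pairing the gradient with jumps, kinks and the candidate -/

section Candidate

variable {T α β : ℝ}

/-- Since g is merely integrable, `dualp g` is only absolutely continuous, with derivative g almost
everywhere; the integration by parts is the one for absolutely continuous functions. -/
lemma integral_sub_mul_eq (hT : 0 ≤ T) (g : L2 T) {a b : ℝ} (ha : 0 ≤ a) (hab : a ≤ b)
    (hb : b ≤ T) (c : ℝ) :
    ∫ t in a..b, (t - c) * g t
      = (b - c) * dualp g b - (a - c) * dualp g a - ∫ t in a..b, dualp g t := by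
  have hg := L2.intervalIntegrable g le_rfl hT le_rfl
  have h0 : (0 : ℝ) ∈ uIcc 0 T := left_mem_uIcc
  have hsub : uIcc a b ⊆ uIcc 0 T := by
    rw [uIcc_of_le hab, uIcc_of_le hT]
    exact Icc_subset_Icc ha hb
  have hp : AbsolutelyContinuousOnInterval (dualp g) a b :=
    (hg.absolutelyContinuousOnInterval_intervalIntegral h0).mono hsub
  have hl : AbsolutelyContinuousOnInterval (fun t => t - c) a b :=
    (contDiff_id.sub contDiff_const).contDiffOn.absolutelyContinuousOnInterval
  have key := hl.integral_mul_deriv_eq_deriv_mul hp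
  have h1 : ∫ t in a..b, (t - c) * deriv (dualp g) t = ∫ t in a..b, (t - c) * g t := by
    refine intervalIntegral.integral_congr_ae ?_
    filter_upwards [hg.ae_hasDerivAt_integral] with t ht htab
    rw [show deriv (dualp g) t = g t from (ht (hsub (uIoc_subset_uIcc htab)) 0 h0).deriv]
  rw [h1] at key
  rw [key]
  simp

lemma inner_affine (g : L2 T) (c d : ℝ) :
    ⟪g, (affine_memLp (T := T) c d).toLp⟫ = ∫ t in Ioo 0 T, g t * (c * t + d) := by
  rw [L2.inner_eq]
  refine integral_congr_ae ?_
  filter_upwards [(affine_memLp (T := T) c d).coeFn_toLp] with t ht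
  rw [ht]

lemma affine_mem_affineSet (c d : ℝ) : ((affine_memLp c d).toLp : L2 T) ∈ affineSet T :=
  ⟨c, d, MemLp.coeFn_toLp _⟩

lemma dualp_right_eq_zero (hT : 0 ≤ T) {g : L2 T} (hg : ∀ l ∈ affineSet T, ⟪g, l⟫ = 0) :
    dualp g T = 0 := by
  have := hg _ (affine_mem_affineSet 0 1)
  rw [inner_affine] at this
  simpa [setIntegral_Ioo_eq hT, dualp] using this

/-- Integrating g(t)·t by parts, with p(T) = 0, turns orthogonality to t into a vanishing integral
of p. -/
lemma dualP_right_eq_zero (hT : 0 ≤ T) {g : L2 T} (hg : ∀ l ∈ affineSet T, ⟪g, l⟫ = 0) :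
    dualP g T = 0 := by
  have h1 := hg _ (affine_mem_affineSet 1 0)
  rw [inner_affine, setIntegral_Ioo_eq hT] at h1
  have h2 := integral_sub_mul_eq hT g le_rfl hT le_rfl 0
  simp only [sub_zero, dualp_right_eq_zero hT hg, mul_zero, zero_mul, zero_sub, one_mul, add_zero,
    mul_comm (g _)] at h1 h2
  rw [dualP, ← h2, h1]

lemma inner_jump {g : L2 T} (hg : ∀ l ∈ affineSet T, ⟪g, l⟫ = 0) {x : ℝ} (hx : x ∈ Ioo 0 T) :
    ⟪g, jump T x⟫ = -dualp g x := by
  have hT : 0 ≤ T := hx.1.le.trans hx.2.le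
  have h1 : ⟪g, jump T x⟫ = ∫ t in Ioo 0 T, (Ioo x T).indicator (fun _ => (1 : ℝ)) t * g t := by
    rw [L2.inner_eq]
    refine integral_congr_ae ?_
    filter_upwards [(memLp_jumpFun T x).coeFn_toLp] with t ht
    rw [jump, ht, mul_comm, jumpFun]
  rw [h1, setIntegral_indicator_mul hx.1.le hx.2.le le_rfl]
  have h2 := intervalIntegral.integral_add_adjacent_intervals
    (L2.intervalIntegrable g le_rfl hx.1.le hx.2.le)
    (L2.intervalIntegrable g hx.1.le hx.2.le le_rfl)
  have h3 := dualp_right_eq_zero hT hg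
  simp only [one_mul]
  unfold dualp at h3 ⊢
  linarith

/-- Both branches are integrated by parts against p. On (0,x) the boundary terms vanish at once; on
(x,T) the conditions p(T) = P(T) = 0 are needed. -/
lemma inner_kink {g : L2 T} (hg : ∀ l ∈ affineSet T, ⟪g, l⟫ = 0) {x : ℝ} (hx : x ∈ Ioo 0 T) :
    ⟪g, kink T x⟫ = -dualP g x := by
  have hT : 0 ≤ T := hx.1.le.trans hx.2.le
  have h1 : ⟪g, kink T x⟫ = ∫ t in Ioo 0 T, kinkFun T x t * g t := by
    rw [L2.inner_eq]
    refine integral_congr_ae ?_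
    filter_upwards [(memLp_kinkFun T x).coeFn_toLp] with t ht
    rw [kink, ht, mul_comm]
  rw [h1]
  unfold kinkFun
  by_cases hxT : x < T / 2
  · simp only [if_pos hxT]
    rw [setIntegral_indicator_mul le_rfl hx.1.le hx.2.le]
    have h2 := integral_sub_mul_eq hT g le_rfl hx.1.le hx.2.le x
    have h3 : dualp g 0 = 0 := intervalIntegral.integral_same
    rw [h3] at h2
    have h4 : ∫ t in (0 : ℝ)..x, (x - t) * g t = -∫ t in (0 : ℝ)..x, (t - x) * g t := by
      rw [← intervalIntegral.integral_neg]
      congr 1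
      funext t
      ring
    rw [h4, h2, dualP]
    ring
  · simp only [if_neg hxT]
    rw [setIntegral_indicator_mul hx.1.le hx.2.le le_rfl]
    have h2 := integral_sub_mul_eq hT g hx.1.le hx.2.le le_rfl x
    rw [dualp_right_eq_zero hT hg] at h2
    have h3 := intervalIntegral.integral_add_adjacent_intervals
      (intervalIntegrable_dualp g le_rfl hx.1.le hx.2.le)
      (intervalIntegrable_dualp g hx.1.le hx.2.le le_rfl)
    have h4 := dualP_right_eq_zero hT hg
    rw [h2]
    unfold dualP at h4 ⊢
    linarith

lemma sign_mul_self (y : ℝ) : Real.sign y * y = |y| := by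
  rcases lt_trichotomy y 0 with h | rfl | h
  · rw [Real.sign_of_neg h, abs_of_neg h]; ring
  · simp
  · rw [Real.sign_of_pos h, abs_of_pos h]; ring

/-- The larger quotient selects the atom, and its sign turns the dual value at the maximal point
into an absolute value. Together with `tgv_candidate_le`, this shows that the candidate is extremal
in the duality estimate. -/
lemma inner_candidate {g : L2 T} (hg : ∀ l ∈ affineSet T, ⟪g, l⟫ = 0) {xS xK : ℝ}
    (hS : xS ∈ Ioo 0 T) (hK : xK ∈ Ioo 0 T) (hS' : |dualp g xS| = supNorm T (dualp g))
    (hK' : |dualP g xK| = supNorm T (dualP g)) :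
    ⟪g, candidate α β g xS xK⟫ = -dualMax α β g := by
  unfold candidate dualMax
  split_ifs with h
  · rw [inner_smul_right, inner_jump hg hS, max_eq_left h, ← hS', ← sign_mul_self]
    ring
  · rw [inner_smul_right, inner_kink hg hK, max_eq_right (not_le.1 h).le, ← hK', ← sign_mul_self]
    ring

lemma norm_jump_le (x : ℝ) : ‖jump T x‖ ≤ ‖oneL2 T‖ := by
  refine Lp.norm_le_norm_of_ae_le ?_
  filter_upwards [(memLp_jumpFun T x).coeFn_toLp, coeFn_oneL2 (T := T)] with t h1 h2
  rw [jump, h1, h2, jumpFun, norm_one]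
  by_cases h : t ∈ Ioo x T <;> simp [h]

lemma norm_kink_le {x : ℝ} (hx : x ∈ Ioo 0 T) : ‖kink T x‖ ≤ T * ‖oneL2 T‖ := by
  have hT : 0 ≤ T := hx.1.le.trans hx.2.le
  refine Lp.norm_le_mul_norm_of_ae_le_mul ?_
  filter_upwards [(memLp_kinkFun T x).coeFn_toLp, coeFn_oneL2 (T := T)] with t h1 h2
  rw [kink, h1, h2, norm_one, mul_one, kinkFun, Real.norm_eq_abs, abs_le]
  split_ifs
  · by_cases h : t ∈ Ioo 0 x
    · rw [indicator_of_mem h]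
      constructor <;> linarith [h.1, h.2, hx.1, hx.2]
    · rw [indicator_of_notMem h]
      constructor <;> linarith
  · by_cases h : t ∈ Ioo x T
    · rw [indicator_of_mem h]
      constructor <;> linarith [h.1, h.2, hx.1, hx.2]
    · rw [indicator_of_notMem h]
      constructor <;> linarith

lemma norm_candidate_le (hα : 0 < α) (hβ : 0 < β) (g : L2 T) (xS : ℝ) {xK : ℝ}
    (hK : xK ∈ Ioo 0 T) :
    ‖candidate α β g xS xK‖ ≤ 1 / α * ‖oneL2 T‖ + 1 / β * (T * ‖oneL2 T‖) := by
  have hT : 0 ≤ T := hK.1.le.trans hK.2.le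
  unfold candidate
  split_ifs
  · rw [norm_smul, Real.norm_eq_abs]
    exact (mul_le_mul (abs_sign_div_le hα _) (norm_jump_le xS) (norm_nonneg _)
      (by positivity)).trans (le_add_of_nonneg_right (by positivity))
  · rw [norm_smul, Real.norm_eq_abs]
    exact (mul_le_mul (abs_sign_div_le hβ _) (norm_kink_le hK) (norm_nonneg _)
      (by positivity)).trans (le_add_of_nonneg_left (by positivity))

end Candidate

/-! ### Optimality conditions of the subproblem -/

section Subproblem

variable {T : ℝ}

lemma affineSet_add_smul {l l' : L2 T} (hl : l ∈ affineSet T) (hl' : l' ∈ affineSet T) (s t : ℝ) :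
    s • l + t • l' ∈ affineSet T := by
  obtain ⟨c, d, h⟩ := hl
  obtain ⟨c', d', h'⟩ := hl'
  refine ⟨s * c + t * c', s * d + t * d', ?_⟩
  filter_upwards [h, h', Lp.coeFn_add (s • l) (t • l'), Lp.coeFn_smul s l, Lp.coeFn_smul t l']
    with x h1 h2 h3 h4 h5
  rw [h3, Pi.add_apply, h4, h5, Pi.smul_apply, Pi.smul_apply, h1, h2, smul_eq_mul, smul_eq_mul]
  ring

variable {f : L2 T → ℝ} {A : Finset (L2 T)} {lam : L2 T → ℝ} {l : L2 T}

/-- The affine part is unconstrained, so t ↦ f(u + t l') has a two-sided minimum at 0. -/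
lemma IsSubproblemMin.inner_affine_eq_zero (hf : Differentiable ℝ f)
    (h : IsSubproblemMin f A lam l) {l' : L2 T} (hl' : l' ∈ affineSet T) :
    ⟪gradient f (combine A lam l), l'⟫ = 0 := by
  set u := combine A lam l with hu
  have hd := hasDerivAt_comp_line hf u l' 0
  rw [zero_smul, add_zero] at hd
  refine IsLocalMin.hasDerivAt_eq_zero (Filter.Eventually.of_forall fun t => ?_) hd
  have h1 := h.2.2 lam ((1 : ℝ) • l + t • l') h.1 (affineSet_add_smul h.2.1 hl' 1 t)
  have h2 : combine A lam ((1 : ℝ) • l + t • l') = u + t • l' := by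
    rw [hu, combine, combine, one_smul, add_assoc]
  rw [h2] at h1
  simpa using h1

lemma combine_smul (A : Finset (L2 T)) (lam : L2 T → ℝ) (l : L2 T) (s : ℝ) :
    combine A (fun v => s * lam v) (s • l) = s • combine A lam l := by
  simp only [combine, smul_add, Finset.smul_sum, mul_smul]

/-- Scaling (λ, ℓ) by 1 + t is feasible for t > -1, hence on both sides of 0, and the derivative of
the objective there vanishes. -/
lemma IsSubproblemMin.inner_self_eq (hf : Differentiable ℝ f)
    (h : IsSubproblemMin f A lam l) :
    ⟪gradient f (combine A lam l), combine A lam l⟫ = -∑ v ∈ A, lam v := by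
  set u := combine A lam l with hu
  have hd := hasDerivAt_comp_line hf u u 0
  rw [zero_smul, add_zero] at hd
  have hd' : HasDerivAt (fun t : ℝ => f (u + t • u) + (1 + t) * ∑ v ∈ A, lam v)
      (⟪gradient f u, u⟫ + ∑ v ∈ A, lam v) 0 := by
    simpa using hd.fun_add (((hasDerivAt_id (0 : ℝ)).const_add 1).mul_const (∑ v ∈ A, lam v))
  refine eq_neg_of_add_eq_zero_left (IsLocalMin.hasDerivAt_eq_zero ?_ hd')
  filter_upwards [lt_mem_nhds (show (-1 : ℝ) < 0 by norm_num)] with t ht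
  have h1 := h.2.2 (fun v => (1 + t) * lam v) ((1 + t) • l)
    (fun v hv => mul_nonneg (by linarith) (h.1 v hv))
    (by simpa using affineSet_add_smul h.2.1 h.2.1 (1 + t) 0)
  rw [combine_smul, ← hu, ← Finset.mul_sum] at h1
  simpa [add_smul] using h1

open Classical in
lemma sum_filter_weight {A : Finset (L2 T)} {lam : L2 T → ℝ} :
    ∑ v ∈ A.filter (fun v => lam v ≠ 0), lam v = ∑ v ∈ A, lam v :=
  Finset.sum_filter_ne_zero A

open Classical in
lemma combine_filter_weight {A : Finset (L2 T)} {lam : L2 T → ℝ} {l : L2 T} :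
    combine (A.filter fun v => lam v ≠ 0) lam l = combine A lam l := by
  unfold combine
  rw [Finset.sum_filter_of_ne]
  intro v _ hv h0
  exact hv (by rw [h0, zero_smul])

open Classical in
/-- Comparison of the minimum of the subproblem for `insert c A` with the convex combinations of a
point of the subproblem for `A` and a multiple of the atom `c`. -/
lemma IsSubproblemMin.le_of_insert {c : L2 T} {lam' : L2 T → ℝ} {l' : L2 T}
    (h : IsSubproblemMin f (insert c A) lam' l') (hlam : ∀ v ∈ A, 0 ≤ lam v)
    (hl : l ∈ affineSet T) {s M : ℝ} (hs0 : 0 ≤ s) (hs1 : s ≤ 1) (hM : 0 ≤ M) :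
    f (combine (insert c A) lam' l') + ∑ v ∈ insert c A, lam' v ≤
      f (combine A lam l + s • (M • c - combine A lam l)) + ((1 - s) * ∑ v ∈ A, lam v + s * M) := by
  -- The two contributions are added because c may already belong to A, in which case its weight
  -- collects both.
  have h1 := h.2.2 (fun v => (if v ∈ A then (1 - s) * lam v else 0) + if v = c then s * M else 0)
    ((1 - s) • l) (fun v _ => by
      refine add_nonneg ?_ ?_
      · split_ifs with hv
        · exact mul_nonneg (by linarith) (hlam v hv)
        · exact le_rfl
      · split_ifs
        · positivity
        · exact le_rfl)
    (by simpa using affineSet_add_smul hl hl (1 - s) 0)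
  have hinter : insert c A ∩ A = A := Finset.inter_eq_right.2 (Finset.subset_insert c A)
  have h2 : ∑ v ∈ insert c A,
      ((if v ∈ A then (1 - s) * lam v else 0) + if v = c then s * M else 0)
      = (1 - s) * ∑ v ∈ A, lam v + s * M := by
    rw [Finset.sum_add_distrib, Finset.sum_ite_mem, hinter, Finset.sum_ite_eq', ← Finset.mul_sum,
      if_pos (Finset.mem_insert_self c A)]
  have h3 : combine (insert c A)
      (fun v => (if v ∈ A then (1 - s) * lam v else 0) + if v = c then s * M else 0) ((1 - s) • l)
      = combine A lam l + s • (M • c - combine A lam l) := by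
    have e1 : combine (insert c A)
        (fun v => (if v ∈ A then (1 - s) * lam v else 0) + if v = c then s * M else 0)
        ((1 - s) • l) = (1 - s) • combine A lam l + (s * M) • c := by
      rw [← combine_smul]
      unfold combine
      simp only [add_smul, ite_smul, zero_smul]
      rw [Finset.sum_add_distrib, Finset.sum_ite_mem, hinter, Finset.sum_ite_eq',
        if_pos (Finset.mem_insert_self c A)]
      abel
    rw [e1]
    module
  rwa [h2, h3] at h1

end Subproblem

/-! ### From the descent inequality to the sublinear rate -/

section Rate

/-- The sublinear rate of the generalized conditional gradient method. -/
lemma le_div_of_descent {r : ℕ → ℝ} {D : ℝ} (hD : 0 < D) (hr : ∀ k ≥ 1, 0 ≤ r k)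
    (h : ∀ k ≥ 1, ∀ s, 0 ≤ s → s ≤ 1 → r (k + 1) ≤ r k - s * r k + 2 * D * s ^ 2) :
    ∀ k ≥ 1, r k ≤ r 1 / (1 + r 1 / (8 * D) * ((k : ℝ) - 1)) := by
  -- This is 1/r_{k+1} ≥ 1/r_k + 1/(8D) with denominators cleared, so that vanishing residuals need
  -- no separate treatment.
  have hstep : ∀ k ≥ 1, r (k + 1) * (8 * D + r k) ≤ 8 * D * r k := by
    intro k hk
    have hx := hr k hk
    by_cases hc : r k ≤ 4 * D
    -- This s minimizes -s r_k + 2D s²; it is admissible exactly when r_k ≤ 4D. Otherwise s = 1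
    -- gives r_{k+1} ≤ 2D, which suffices.
    · have h1 := h k hk (r k / (4 * D)) (by positivity) ((div_le_one (by positivity)).2 hc)
      have h2 : r k - r k / (4 * D) * r k + 2 * D * (r k / (4 * D)) ^ 2
          = r k * (8 * D - r k) / (8 * D) := by
        field_simp
        ring
      rw [h2, le_div_iff₀ (by positivity)] at h1
      have h3 := mul_le_mul_of_nonneg_right h1 (show 0 ≤ 8 * D + r k by positivity)
      have h4 : 0 ≤ r k ^ 3 := by positivity
      have h5 : (r (k + 1) * (8 * D + r k)) * (8 * D) ≤ (8 * D * r k) * (8 * D) := by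
        nlinarith
      exact le_of_mul_le_mul_right h5 (by positivity)
    · have h1 := h k hk 1 zero_le_one le_rfl
      nlinarith [hr (k + 1) (by omega)]
  have key : ∀ j : ℕ, r (j + 1) * (8 * D + r 1 * j) ≤ 8 * D * r 1 := by
    intro j
    have h1 := hr 1 le_rfl
    induction j with
    | zero => simp [mul_comm]
    | succ j ih =>
      have h2 := hstep (j + 1) (by omega)
      have h3 := hr (j + 1) (by omega)
      have h4 : 0 ≤ 8 * D + r 1 * (j + 1) := by positivity
      push_cast
      have h5 := mul_le_mul_of_nonneg_right h2 h4
      refine le_of_mul_le_mul_right (a := 8 * D + r (j + 1)) ?_ (by positivity)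
      nlinarith
  intro k hk
  obtain ⟨j, rfl⟩ : ∃ j, k = j + 1 := ⟨k - 1, by omega⟩
  have h1 := hr 1 le_rfl
  push_cast
  rw [add_sub_cancel_right, le_div_iff₀ (by positivity)]
  refine le_of_mul_le_mul_right (a := 8 * D) ?_ (by positivity)
  refine le_trans (le_of_eq ?_) ((key j).trans_eq (mul_comm _ _))
  field_simp

lemma isBigO_one_div_of_le {r : ℕ → ℝ} {q : ℝ} (hr : ∀ k ≥ 1, 0 ≤ r k)
    (hq : r 1 ≠ 0 → 0 < q)
    (h : ∀ k ≥ 1, r k ≤ r 1 / (1 + q * ((k : ℝ) - 1))) :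
    r =O[atTop] fun k : ℕ => 1 / (k : ℝ) := by
  -- The constant comes from 1 + q(k-1) ≥ min(1,q)·k. Positivity of q is available only when r 1 ≠
  -- 0, so r 1 = 0 is treated apart.
  refine Asymptotics.IsBigO.of_bound (r 1 / min 1 q) ?_
  filter_upwards [eventually_ge_atTop 1] with k hk
  have hk' : (1 : ℝ) ≤ k := by exact_mod_cast hk
  rw [Real.norm_of_nonneg (hr k hk), Real.norm_of_nonneg (by positivity)]
  refine (h k hk).trans ?_
  by_cases h1 : r 1 = 0
  · simp [h1]
  · have hmin : 0 < min 1 q := lt_min one_pos (hq h1)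
    rw [div_mul_div_comm, mul_one]
    refine div_le_div_of_nonneg_left (hr 1 le_rfl) (by positivity) ?_
    have e1 := min_le_left 1 q
    have e2 := min_le_right 1 q
    nlinarith

end Rate

/-! ### Properties of the iterates -/

namespace Run

variable {T α β : ℝ} {f : L2 T → ℝ}

open Classical in
/-- Every iterate comes from a subproblem whose atoms have `TGV` at most `1`. -/
lemma exists_subproblem (hα : 0 < α) (hβ : 0 < β) (R : Run T α β f) :
    ∀ k ≥ 1, ∃ B : Finset (L2 T), (∀ v ∈ B, tgv T α β v ≤ ENNReal.ofReal 1) ∧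
      IsSubproblemMin f B (R.lam k) (R.ell k) ∧ R.u k = combine B (R.lam k) (R.ell k) ∧
      R.A k = B.filter fun v => R.lam k v ≠ 0 := by
  intro k hk
  induction k, hk using Nat.le_induction with
  | base =>
    exact ⟨R.A 0, fun v hv => tgv_le_of_mem_extB hα hβ (R.input v hv), R.init_min, R.init_u,
      R.init_A⟩
  | succ k hk ih =>
    obtain ⟨B, hB, -, -, hA⟩ := ih
    refine ⟨_, fun v hv => ?_, R.step_min k hk, R.step_u k hk, R.step_A k hk⟩
    rcases Finset.mem_insert.1 hv with rfl | hv
    -- The kink node is only known to lie in (0,T), so the invariant is TGV ≤ 1 rather than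
    -- membership in `extB`.
    · exact tgv_candidate_le hα hβ _ (R.xS_mem k hk) (R.xK_mem k hk)
    · rw [hA] at hv
      exact hB v (Finset.mem_of_mem_filter v hv)

section

variable (R : Run T α β f) {k : ℕ}

lemma weight_nonneg (hα : 0 < α) (hβ : 0 < β) (hk : 1 ≤ k) : ∀ v ∈ R.A k, 0 ≤ R.lam k v := by
  obtain ⟨B, -, hmin, -, hA⟩ := R.exists_subproblem hα hβ k hk
  intro v hv
  rw [hA] at hv
  exact hmin.1 v (Finset.mem_of_mem_filter v hv)

lemma ell_mem (hα : 0 < α) (hβ : 0 < β) (hk : 1 ≤ k) : R.ell k ∈ affineSet T := by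
  obtain ⟨B, -, hmin, -, -⟩ := R.exists_subproblem hα hβ k hk
  exact hmin.2.1

lemma u_eq_combine (hα : 0 < α) (hβ : 0 < β) (hk : 1 ≤ k) :
    R.u k = combine (R.A k) (R.lam k) (R.ell k) := by
  obtain ⟨B, -, -, hu, hA⟩ := R.exists_subproblem hα hβ k hk
  rw [hu, hA, combine_filter_weight]

lemma tgv_u_le (hT : 0 < T) (hα : 0 < α) (hβ : 0 < β) (hk : 1 ≤ k) :
    tgv T α β (R.u k) ≤ ENNReal.ofReal (∑ v ∈ R.A k, R.lam k v) := by
  obtain ⟨B, hB, -, -, hA⟩ := R.exists_subproblem hα hβ k hk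
  rw [R.u_eq_combine hα hβ hk]
  refine tgv_combine_le hT hα hβ (fun v hv => ?_) (R.weight_nonneg hα hβ hk) (R.ell_mem hα hβ hk)
  rw [hA] at hv
  exact hB v (Finset.mem_of_mem_filter v hv)

lemma u_mem_bvSet (hT : 0 < T) (hα : 0 < α) (hβ : 0 < β) (hk : 1 ≤ k) : R.u k ∈ bvSet T :=
  mem_bvSet_of_tgv_le hα hβ (Finset.sum_nonneg (R.weight_nonneg hα hβ hk))
    (R.tgv_u_le hT hα hβ hk)

lemma J_sub_minJ_le_residual (hT : 0 < T) (hα : 0 < α) (hβ : 0 < β) (hk : 1 ≤ k) :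
    J T α β f (R.u k) - minJ T α β f ≤ R.residual k := by
  have := ENNReal.toReal_le_of_le_ofReal (Finset.sum_nonneg (R.weight_nonneg hα hβ hk))
    (R.tgv_u_le hT hα hβ hk)
  unfold J residual
  linarith

lemma inner_gradient_affine (hf : Differentiable ℝ f) (hα : 0 < α) (hβ : 0 < β) (hk : 1 ≤ k) :
    ∀ l ∈ affineSet T, ⟪gradient f (R.u k), l⟫ = 0 := by
  obtain ⟨B, -, hmin, hu, -⟩ := R.exists_subproblem hα hβ k hk
  rw [hu]
  exact fun l hl => hmin.inner_affine_eq_zero hf hl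

lemma inner_gradient_self (hf : Differentiable ℝ f) (hα : 0 < α) (hβ : 0 < β) (hk : 1 ≤ k) :
    ⟪gradient f (R.u k), R.u k⟫ = -∑ v ∈ R.A k, R.lam k v := by
  obtain ⟨B, -, hmin, hu, hA⟩ := R.exists_subproblem hα hβ k hk
  rw [hA, sum_filter_weight, hu]
  exact hmin.inner_self_eq hf

lemma inner_gradient_uhat (hf : Differentiable ℝ f) (hα : 0 < α) (hβ : 0 < β) (hk : 1 ≤ k) :
    ⟪gradient f (R.u k), R.uhat k⟫ = -dualMax α β (gradient f (R.u k)) :=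
  inner_candidate (R.inner_gradient_affine hf hα hβ hk) (R.xS_mem k hk) (R.xK_mem k hk)
    (R.xS_max k hk) (R.xK_max k hk)

end

/-- Failure of the stopping test makes Ψ nonnegative, which is what allows TGV(z) to be replaced by
its upper bound M₀. -/
lemma one_le_dualMax (hα : 0 < α) (hβ : 0 < β) (R : Run T α β f) {k : ℕ} (hk : 1 ≤ k) :
    1 ≤ dualMax α β (gradient f (R.u k)) := by
  by_contra hc
  rw [dualMax, le_max_iff, not_or, not_le, not_le, div_lt_one hα, div_lt_one hβ] at hc
  exact Run.not_stop R k hk ⟨hc.1.le, hc.2.le⟩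

/-- For a minimizer z, convexity and ⟨g, u_k⟩ = -∑ λ bound the residual by -⟨g, z⟩ - TGV(z). The
duality estimate bounds this by (`dualMax` - 1) TGV(z), and comparison with J(0) gives TGV(z) ≤ M₀.
-/
lemma residual_le_violation (hT : 0 < T) (hα : 0 < α) (hβ : 0 < β) (hf : Differentiable ℝ f)
    (hconv : ConvexOn ℝ univ f) {Cf : ℝ} (hbdd : ∀ v, -Cf ≤ f v)
    (hmin : IsLeast (J T α β f '' bvSet T) (minJ T α β f)) (R : Run T α β f) {k : ℕ}
    (hk : 1 ≤ k) : R.residual k ≤ R.violation (f 0 + Cf) k := by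
  obtain ⟨z, hz, hJz⟩ := hmin.1
  have h0 : minJ T α β f ≤ f 0 := by
    refine (hmin.2 ⟨0, zero_mem_bvSet, rfl⟩).trans_eq ?_
    have h1 : tgv T α β (0 : L2 T) ≤ ENNReal.ofReal 0 :=
      tgv_affine_le hT hα hβ ⟨0, 0, by
        simp only [zero_mul, add_zero]
        exact Lp.coeFn_zero ℝ 2 _⟩
    have h2 := ENNReal.toReal_le_of_le_ofReal le_rfl h1
    rw [J, le_antisymm h2 ENNReal.toReal_nonneg, add_zero]
  have h1 := add_inner_gradient_le hf hconv (R.u k) z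
  rw [inner_sub_right, R.inner_gradient_self hf hα hβ hk] at h1
  have h2 := neg_inner_le_dualMax_mul_tgv hT hα hβ (R.inner_gradient_affine hf hα hβ hk) hz
  have h3 := R.one_le_dualMax hα hβ hk
  unfold J at hJz
  have h4 : (tgv T α β z).toReal ≤ f 0 + Cf := by linarith [hbdd z]
  have h5 := mul_le_mul_of_nonneg_left h4 (sub_nonneg.2 h3)
  unfold residual violation
  nlinarith

open Classical in
-- Along M û_k - u_k the slope of f is -M·`dualMax` + ∑ λ and the slope of the weights is M - ∑ λ;
-- they add up to minus the violation. The last term is the quadratic error of the Lipschitz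
-- gradient.
lemma residual_succ_le (hα : 0 < α) (hβ : 0 < β) (hf : Differentiable ℝ f) {L : ℝ}
    (hL : ∀ v w : L2 T, ‖gradient f v - gradient f w‖ ≤ L * ‖v - w‖) {M : ℝ} (hM : 0 ≤ M)
    (R : Run T α β f) {k : ℕ} (hk : 1 ≤ k) {s : ℝ} (hs0 : 0 ≤ s) (hs1 : s ≤ 1) :
    R.residual (k + 1) ≤ R.residual k - s * R.violation M k
      + L / 2 * (s ^ 2 * ‖M • R.uhat k - R.u k‖ ^ 2) := by
  have h1 := (R.step_min k hk).le_of_insert (R.weight_nonneg hα hβ hk) (R.ell_mem hα hβ hk)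
    hs0 hs1 hM
  rw [← R.step_u k hk, ← sum_filter_weight, ← R.step_A k hk, ← R.u_eq_combine hα hβ hk] at h1
  have h2 := le_add_inner_gradient_add_sq hf hL (R.u k) (s • (M • R.uhat k - R.u k))
  rw [inner_smul_right, inner_sub_right, inner_smul_right, R.inner_gradient_self hf hα hβ hk,
    R.inner_gradient_uhat hf hα hβ hk, norm_smul, mul_pow, Real.norm_eq_abs, sq_abs] at h2
  change _ ≤ f (R.u k + s • (M • R.uhat k - R.u k)) + _ at h1
  unfold residual violation
  linarith

end Run

end TGV

/-! ### Assembly of the theorem -/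

theorem theorem5 (T α β : ℝ) (hT : 0 < T) (hα : 0 < α) (hβ : 0 < β)
    (f : TGV.L2 T → ℝ) (hf_diff : ContDiff ℝ 1 f)
    (Lf : ℝ) (hLf : 0 < Lf)
    (hf_lip : ∀ v w : TGV.L2 T, ‖gradient f v - gradient f w‖ ≤ Lf * ‖v - w‖)
    (Cf : ℝ) (hCf : 0 < Cf) (hf_bdd : ∀ v : TGV.L2 T, -Cf ≤ f v)
    (hJ_coercive : ∀ c : ℝ, ∃ R : ℝ, ∀ v ∈ TGV.bvSet T, TGV.J T α β f v ≤ c →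
      TGV.bvNorm T v ≤ ENNReal.ofReal R)
    (hf_convex : ConvexOn ℝ Set.univ f)
    (R : TGV.Run T α β f) :
    IsLeast (TGV.J T α β f '' TGV.bvSet T) (TGV.minJ T α β f) ∧
    (∀ k ≥ 1, TGV.J T α β f (R.u k) - TGV.minJ T α β f ≤ R.residual k ∧
      R.residual k ≤ R.violation (f 0 + Cf) k) ∧
    (∀ C > 0, (∀ k ≥ 1, max ‖R.u k‖ ((f 0 + Cf) * ‖R.uhat k‖) ≤ C) →
      ∀ k ≥ 1, TGV.J T α β f (R.u k) - TGV.minJ T α β f ≤ R.residual k ∧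
        R.residual k ≤
          R.residual 1 / (1 + R.residual 1 / (8 * Lf * C ^ 2) * ((k : ℝ) - 1))) ∧
    (fun k : ℕ => R.residual k) =O[atTop] (fun k : ℕ => 1 / (k : ℝ)) := by
  have hf : Differentiable ℝ f := hf_diff.differentiable one_ne_zero
  have hmin := TGV.exists_minimizer hT hα hβ hf hf_convex hf_bdd hJ_coercive
  have hM : 0 ≤ f 0 + Cf := by linarith [hf_bdd 0]
  have hJr : ∀ k ≥ 1, TGV.J T α β f (R.u k) - TGV.minJ T α β f ≤ R.residual k :=
    fun k hk => R.J_sub_minJ_le_residual hT hα hβ hk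
  have hviol : ∀ k ≥ 1, R.residual k ≤ R.violation (f 0 + Cf) k :=
    fun k hk => R.residual_le_violation hT hα hβ hf hf_convex hf_bdd hmin hk
  have hr0 : ∀ k ≥ 1, 0 ≤ R.residual k := fun k hk =>
    (sub_nonneg.2 (hmin.2 ⟨R.u k, R.u_mem_bvSet hT hα hβ hk, rfl⟩)).trans (hJr k hk)
  have hrate : ∀ C > 0, (∀ k ≥ 1, max ‖R.u k‖ ((f 0 + Cf) * ‖R.uhat k‖) ≤ C) → ∀ k ≥ 1,
      R.residual k ≤ R.residual 1 / (1 + R.residual 1 / (8 * Lf * C ^ 2) * ((k : ℝ) - 1)) := by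
    intro C hC hb
    -- The descent lemma is used with D = Lf * C ^ 2: as ‖M₀ û_k - u_k‖ ≤ 2C, the quadratic term is
    -- at most 2D s².
    rw [mul_assoc]
    refine TGV.le_div_of_descent (by positivity) hr0 fun k hk s hs0 hs1 => ?_
    have h1 := R.residual_succ_le hα hβ hf hf_lip hM hk hs0 hs1
    have h2 : ‖(f 0 + Cf) • R.uhat k - R.u k‖ ≤ 2 * C := by
      refine (norm_sub_le _ _).trans ?_
      rw [norm_smul, Real.norm_of_nonneg hM]
      linarith [(le_max_left _ _).trans (hb k hk), (le_max_right _ _).trans (hb k hk)]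
    have h3 : ‖(f 0 + Cf) • R.uhat k - R.u k‖ ^ 2 ≤ (2 * C) ^ 2 := by gcongr
    have h4 := mul_le_mul_of_nonneg_left (hviol k hk) hs0
    have h5 : Lf / 2 * (s ^ 2 * ‖(f 0 + Cf) • R.uhat k - R.u k‖ ^ 2)
        ≤ Lf / 2 * (s ^ 2 * (2 * C) ^ 2) := by gcongr
    linarith
  refine ⟨hmin, fun k hk => ⟨hJr k hk, hviol k hk⟩,
    fun C hC hb k hk => ⟨hJr k hk, hrate C hC hb k hk⟩, ?_⟩
  have hmono : ∀ k ≥ 1, R.residual k ≤ R.residual 1 := by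
    intro k hk
    induction k, hk using Nat.le_induction with
    | base => exact le_rfl
    | succ k hk ih =>
      -- Here s = 0.
      have h1 := R.residual_succ_le hα hβ hf hf_lip hM hk le_rfl zero_le_one
      have h2 : R.residual (k + 1) ≤ R.residual k := by simpa using h1
      exact h2.trans ih
  -- An admissible C always exists: by monotonicity all iterates stay in one sublevel set of J,
  -- hence are bounded in BV and so in L², and the candidates are bounded uniformly.
  obtain ⟨ρ, hρ⟩ := hJ_coercive (R.residual 1 + TGV.minJ T α β f)
  obtain ⟨C₁, hC₁, hC₁u⟩ := TGV.exists_norm_le_of_bvNorm_le hT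
  have hu : ∀ k ≥ 1, ‖R.u k‖ ≤ C₁ * max ρ 0 := fun k hk =>
    hC₁u _ _ (le_max_right _ _) ((hρ _ (R.u_mem_bvSet hT hα hβ hk)
      (by linarith [hJr k hk, hmono k hk])).trans (ENNReal.ofReal_le_ofReal (le_max_left _ _)))
  have huhat : ∀ k ≥ 1, ‖R.uhat k‖ ≤ 1 / α * ‖TGV.oneL2 T‖ + 1 / β * (T * ‖TGV.oneL2 T‖) :=
    fun k hk => TGV.norm_candidate_le hα hβ _ _ (R.xK_mem k hk)
  set C₂ := 1 / α * ‖TGV.oneL2 T‖ + 1 / β * (T * ‖TGV.oneL2 T‖)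
  have hC₂ : 0 ≤ C₂ := by positivity
  have hC : 0 < C₁ * max ρ 0 + (f 0 + Cf) * C₂ + 1 := by positivity
  refine TGV.isBigO_one_div_of_le hr0 (fun h1 => ?_) (hrate _ hC fun k hk => max_le ?_ ?_)
  · have : 0 < R.residual 1 := lt_of_le_of_ne (hr0 1 le_rfl) (Ne.symm h1)
    positivity
  · have : 0 ≤ (f 0 + Cf) * C₂ := by positivity
    linarith [hu k hk]
  · have h1 : 0 ≤ C₁ * max ρ 0 := by positivity
    have h2 := mul_le_mul_of_nonneg_left (huhat k hk) hM
    linarith
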